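/- **Definitions.** A *partial pair* $(A,j)$ is a non-empty set $A$ with a partial injection $j:A^*\times A\rightharpoonup A$, where $A^*$ is the set of finite subsets of $A$; an isomorphism of partial pairs is a bijection that preserves $j$ in both directions. A *total pair* $(G,i)$ is an infinite set $G$ with a total injection $i:G^*\times G\to G$. The *graph model* with web $(G,i)$ has domain $(\mathcal P(G),\subseteq)$, application $\mathrm{Ap}(X)(Y)=\{\alpha : \exists a\subseteq Y \text{ finite},\ i(a,\alpha)\in X\}$ and abstraction $\lambda(f)=\{i(a,\alpha) : a\in G^*,\ \alpha\in f(a)\}$ for Scott-continuous $f:\mathcal P(G)\to\mathcal P(G)$. A $\lambda$-term $M$ is interpreted in an environment $\rho:\mathrm{Var}\to\mathcal P(G)$ by $|x|_\rho=\rho(x)$, $|MN|_\rho=\mathrm{Ap}(|M|_\rho)(|N|_\rho)$, $|\lambda x.M|_\rho=\lambda(X\mapsto |M|_{\rho[x:=X]})$. Its *order theory* is the set of pairs $(M,N)$ of $\lambda$-terms with $|M|_\rho\subseteq|N|_\rho$ for all $\rho$; its *equational theory* is defined in the same way with $=$ in place of $\subseteq$. The *free completion* of a partial pair $(A,j)$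 (up to isomorphism, no element of $A$ being an ordered pair) is the total pair on $\bigcup_n A_n$, where $A_0=A$ and $A_{n+1}=A\cup((A_n^*\times A_n)\setminus\mathrm{dom}(j))$, with $i(a,\alpha)=j(a,\alpha)$ if $(a,\alpha)\in\mathrm{dom}(j)$ and $i(a,\alpha)=(a,\alpha)$ otherwise. A pair is *effective* if it is isomorphic to a pair $(E,\ell)$ with $E\subseteq\mathbb N$ decidable and $\ell$ partial recursive with decidable domain and decidable range. A graph model with web $(G,i)$ is an *effective $\lambda$-model* if there is a surjection $d$ from $\mathbb N$ onto the finite subsets of $G$ such that: the relations "$d_m,d_n$ have an upper bound" and "$d_m=d_n\cup d_k$" are decidable; $\mathrm{Ap}$ and $\lambda$ are r.e. elements of the effective domains $[D\to[D\to D]]$ and $[[D\to D]\to D]$, $D=\mathcal P(G)$ (i.e. the set of indices of the compact elements below each of them is r.e., where the compact elements of function spaces are indexed, as finite joins of step functions, by finite lists of pairs of indices); if $e\in D$ is compact and $e_1,\dots,e_k\in D$ are decidable (where $X\in D$ is decidable if $\{n : d_n\subseteq X\}$ is), then $e\,e_1\cdots e_k$ is decidable; and if $f:D\to D$ is continuous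 with $f(d_m)$ decidable uniformly in $m$ (i.e. $\{(m,n) : d_n\subseteq f(d_m)\}$ is decidable), then $\lambda(f)$ is decidable. **Theorem.** There exists an effective graph model whose order theory is the minimum order graph theory and whose equational theory is the minimum equational graph theory. More precisely, there is an effective numeration $(N_k)_{k\in\mathbb N}$ of all the finite partial pairs with carrier included in $\mathbb N$ (from $k$ one can compute a finite list of the elements of the carrier and a finite table of the partial map of $N_k$) such that the free completion $\mathcal G$ of the disjoint union $\bigsqcup_{k} N_k$ (with $x\in N_k$ renamed to $(k,x)$) has the following properties: $\mathcal G$ is an effective total pair; the graph model with web $\mathcal G$ is an effective $\lambda$-model; its order theory is contained in the order theory of every graph model; and its equational theory is contained in the equational theory of every graph model. -/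

import Mathlib

namespace GraphModel

universe u v

/-- Raw untyped lambda-terms over the countable set of variables `ℕ`. -/
inductive Term : Type
  | var : ℕ → Term
  | app : Term → Term → Term
  | lam : ℕ → Term → Term

/-! ### Partial pairs -/

/-- A partial pair `(A, j)`: a non-empty set `A` (here a subset of an ambient type `U`) with a
partial injection `j` from (finite subsets of `A`) × `A` to `A`. -/
structure PartialPair (U : Type u) where
  carrier : Set U
  nonempty : carrier.Nonempty
  j : Finset U × U →. U
  mem_carrier : ∀ (a : Finset U) (α y : U), y ∈ j (a, α) →
    (a : Set U) ⊆ carrier ∧ α ∈ carrier ∧ y ∈ carrier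
  inj : ∀ (p q : Finset U × U) (y : U), y ∈ j p → y ∈ j q → p = q

namespace PartialPair

variable {U : Type u} {V : Type v}

/-- `θ` is an isomorphism of partial pairs: a bijection between the carriers such that `θ` and its
inverse are morphisms. -/
def IsIso (A : PartialPair U) (B : PartialPair V) (θ : U → V) : Prop :=
  Set.BijOn θ A.carrier B.carrier ∧
    ∀ (a : Finset U) (α y : U) (b : Finset V),
      (a : Set U) ⊆ A.carrier → α ∈ A.carrier → y ∈ A.carrier → (b : Set V) = θ '' (a : Set U) →
        (y ∈ A.j (a, α) ↔ θ y ∈ B.j (b, θ α))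

/-- Effective partial pairs: isomorphic to a pair `(E, ℓ)` with `E` a decidable set of natural
numbers and `ℓ` partial recursive with decidable domain and decidable range. Finite sets of
natural numbers are given to algorithms as lists. -/
def IsEffective (A : PartialPair U) : Prop :=
  ∃ (B : PartialPair ℕ) (θ : U → ℕ), A.IsIso B θ ∧
    ComputablePred (fun n : ℕ => n ∈ B.carrier) ∧
    Partrec (fun p : List ℕ × ℕ => B.j (p.1.toFinset, p.2)) ∧
    ComputablePred (fun p : List ℕ × ℕ => (B.j (p.1.toFinset, p.2)).Dom) ∧
    ComputablePred (fun n : ℕ => ∃ p, n ∈ B.j p)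

/-- `N 0, N 1, …` is an effective numeration (possibly with repetitions) of all the finite partial
pairs whose carrier is a set of natural numbers: from `k` one can compute a list of the elements of
the carrier of `N k` and a list of the entries `((a, α), j(a, α))` of the graph of its partial
map. -/
structure IsEffectiveNumeration (N : ℕ → PartialPair ℕ) : Prop where
  finite : ∀ k, (N k).carrier.Finite
  surjective : ∀ B : PartialPair ℕ, B.carrier.Finite → ∃ k, N k = B
  effective : ∃ c : ℕ → List ℕ × List ((List ℕ × ℕ) × ℕ), Computable c ∧
    (∀ k x, x ∈ (N k).carrier ↔ x ∈ (c k).1) ∧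
    ∀ k a α y, y ∈ (N k).j (a, α) ↔ ∃ l : List ℕ, l.toFinset = a ∧ ((l, α), y) ∈ (c k).2

/-- The disjoint union of a sequence of partial pairs: the element `x` of `N k` is renamed to
`(k, x)`, so that `j ({(k, α₁), …, (k, αₙ)}, (k, α)) = (k, j_k ({α₁, …, αₙ}, α))`, and `j` is
undefined at all other arguments. -/
def disjointUnion (N : ℕ → PartialPair ℕ) : PartialPair (ℕ × ℕ) where
  carrier := {q | q.2 ∈ (N q.1).carrier}
  nonempty := by
    obtain ⟨x, hx⟩ := (N 0).nonempty
    exact ⟨(0, x), hx⟩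
  j := fun p => Part.assert (∀ q ∈ p.1, q.1 = p.2.1) fun _ =>
    ((N p.2.1).j (p.1.image Prod.snd, p.2.2)).map (Prod.mk p.2.1)
  mem_carrier := by
    rintro a ⟨k, α⟩ y hy
    simp only [Part.mem_assert_iff, Part.mem_map_iff] at hy
    obtain ⟨h, z, hz, rfl⟩ := hy
    obtain ⟨h1, h2, h3⟩ := (N k).mem_carrier _ _ _ hz
    refine ⟨fun q hq => ?_, h2, h3⟩
    have hk : q.1 = k := h q hq
    have : q.2 ∈ (N k).carrier := h1 (by
      simp only [Finset.coe_image]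
      exact ⟨q, hq, rfl⟩)
    simpa [hk] using this
  inj := by
    rintro ⟨a, k, α⟩ ⟨b, l, β⟩ y hp hq
    simp only [Part.mem_assert_iff, Part.mem_map_iff] at hp hq
    obtain ⟨h, z, hz, rfl⟩ := hp
    obtain ⟨h', z', hz', he⟩ := hq
    obtain ⟨rfl, rfl⟩ := Prod.mk.inj he
    have e := (N l).inj _ _ _ hz hz'
    obtain ⟨e1, rfl⟩ := Prod.mk.inj e
    have : a = b := by
      ext ⟨m, x⟩
      have key : ∀ c : Finset (ℕ × ℕ), (∀ q ∈ c, q.1 = l) →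
          ((m, x) ∈ c ↔ m = l ∧ x ∈ c.image Prod.snd) := by
        intro c hc
        constructor
        · intro hm
          exact ⟨hc _ hm, Finset.mem_image.2 ⟨_, hm, rfl⟩⟩
        · rintro ⟨rfl, hx⟩
          obtain ⟨⟨m', x'⟩, hm', rfl⟩ := Finset.mem_image.1 hx
          have : m' = m := hc _ hm'
          exact this ▸ hm'
      rw [key a h, key b h', e1]
    rw [this]

end PartialPair

/-! ### Total pairs and graph models -/

/-- A total pair: an infinite set `G` with an injection `i` from (finite subsets of `G`) × `G` to
`G`. It is the web of a graph model. -/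
structure TotalPair (G : Type u) where
  infinite : Infinite G
  i : Finset G × G → G
  inj : Function.Injective i

namespace TotalPair

variable {G : Type u} {U : Type v}

/-- A total pair regarded as a partial pair. -/
def toPartialPair (W : TotalPair G) : PartialPair G where
  carrier := Set.univ
  nonempty := by
    have := W.infinite
    exact Set.univ_nonempty
  j := fun p => Part.some (W.i p)
  mem_carrier := fun _ _ _ _ => ⟨Set.subset_univ _, trivial, trivial⟩
  inj := by
    intro p q y hp hq
    rw [Part.mem_some_iff] at hp hq
    exact W.inj (hp.symm.trans hq)

/-- Application in the graph model with web `W`, whose domain is the powerset of `G`. -/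
def ap (W : TotalPair G) (X Y : Set G) : Set G :=
  {α | ∃ a : Finset G, (a : Set G) ⊆ Y ∧ W.i (a, α) ∈ X}

/-- Abstraction in the graph model with web `W`; it is meant for Scott-continuous `f`. -/
def abs (W : TotalPair G) (f : Set G → Set G) : Set G :=
  {y | ∃ (a : Finset G) (α : G), α ∈ f (a : Set G) ∧ y = W.i (a, α)}

/-- Interpretation of lambda-terms in the graph model with web `W`. -/
def interp (W : TotalPair G) : Term → (ℕ → Set G) → Set G
  | .var x, ρ => ρ x
  | .app M N, ρ => W.ap (W.interp M ρ) (W.interp N ρ)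
  | .lam x M, ρ => W.abs (fun X => W.interp M (Function.update ρ x X))

/-- The order theory of the graph model with web `W`. -/
def orderTheory (W : TotalPair G) : Set (Term × Term) :=
  {e | ∀ ρ : ℕ → Set G, W.interp e.1 ρ ⊆ W.interp e.2 ρ}

/-- The equational theory of the graph model with web `W`. -/
def eqTheory (W : TotalPair G) : Set (Term × Term) :=
  {e | ∀ ρ : ℕ → Set G, W.interp e.1 ρ = W.interp e.2 ρ}

/-! ### Free completions -/

/-- The copy, along `e : A → G`, of the domain of the partial map of `A`. -/
def imageDom (A : PartialPair U) (e : U → G) : Set (Finset G × G) :=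
  {q | ∃ p : Finset U × U, (A.j p).Dom ∧ (q.1 : Set G) = e '' (p.1 : Set U) ∧ q.2 = e p.2}

/-- The stages of the free completion: `A₀ = A` and
`Aₙ₊₁ = A ∪ ((finite subsets of Aₙ) × Aₙ \ dom j)`, where a pair `(a, α)` outside of the domain
of `j` is represented by the element `i (a, α)`. -/
def stage (W : TotalPair G) (A : PartialPair U) (e : U → G) : ℕ → Set G
  | 0 => e '' A.carrier
  | n + 1 => e '' A.carrier ∪
      {y | ∃ (a : Finset G) (α : G), (a : Set G) ⊆ W.stage A e n ∧ α ∈ W.stage A e n ∧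
        (a, α) ∉ imageDom A e ∧ y = W.i (a, α)}

/-- `W` is the free completion of the partial pair `A`, with `A` embedded by `e`: `i` extends `j`,
the values of `i` outside of the domain of `j` are new elements (formal pairs, distinct from all
elements of `A`), and every element is reached at some stage. This determines `W` up to
isomorphism over `A`. -/
structure IsFreeCompletion (W : TotalPair G) (A : PartialPair U) (e : U → G) : Prop where
  injOn : Set.InjOn e A.carrier
  extends_j : ∀ (a : Finset U) (α y : U) (b : Finset G), y ∈ A.j (a, α) →
    (b : Set G) = e '' (a : Set U) → W.i (b, e α) = e y
  free : ∀ q : Finset G × G, q ∉ imageDom A e → W.i q ∉ e '' A.carrier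
  exhausts : ∀ y : G, ∃ n, y ∈ W.stage A e n

end TotalPair

/-! ### Effective graph models -/

/-- Given numerations `d` and `d'` of the compact elements of `D` and `D'`, the list `L` denotes the
compact element of the function space from `D` to `D'` that is the join of the step functions
`ε (d m) (d' n)`, for `(m, n)` in `L`. -/
def stepJoin {ι κ : Type} {D : Type u} {D' : Type v} [Preorder D] [CompleteLattice D']
    (d : ι → D) (d' : κ → D') (L : List (ι × κ)) (x : D) : D' :=
  ⨆ p ∈ L, ⨆ _ : d p.1 ≤ x, d' p.2

/-- The powerset of `G`, with the numeration `d` of its compact elements (the finite sets), is an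
effective domain. -/
structure IsEffectiveDomain {G : Type u} (d : ℕ → Set G) : Prop where
  range_eq : Set.range d = {a | a.Finite}
  bounded : ComputablePred (fun p : ℕ × ℕ => ∃ X : Set G, d p.1 ⊆ X ∧ d p.2 ⊆ X)
  join : ComputablePred (fun p : ℕ × ℕ × ℕ => d p.1 = d p.2.1 ∪ d p.2.2)

/-- The decidable elements of an effective domain. -/
def IsDecidableElement {G : Type u} (d : ℕ → Set G) (X : Set G) : Prop :=
  ComputablePred (fun n : ℕ => d n ⊆ X)

namespace TotalPair

variable {G : Type u}

/-- The graph model with web `W` is a weakly effective lambda-model with respect to `d`: its domain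
`D` is an effective domain, and application `D → [D → D]` and abstraction `[D → D] → D` are r.e.
elements of the corresponding effective domains of continuous functions, that is, the compact
elements below each of them form an r.e. set. -/
structure IsWeaklyEffectiveModel (W : TotalPair G) (d : ℕ → Set G) : Prop where
  domain : IsEffectiveDomain d
  ap_re : REPred (fun L : List (ℕ × List (ℕ × ℕ)) =>
    ∀ X Y : Set G, stepJoin d (stepJoin d d) L X Y ⊆ W.ap X Y)
  abs_re : REPred (fun L : List (List (ℕ × ℕ) × ℕ) =>
    ∀ f : Set G → Set G, ScottContinuous f → stepJoin (stepJoin d d) d L f ⊆ W.abs f)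

/-- The graph model with web `W` is an effective lambda-model: for some numeration `d` of the
compact elements it is weakly effective, a compact element applied to decidable elements gives a
decidable element, and the abstraction of a continuous function whose values at compact elements
are decidable, uniformly in the compact element, is decidable. -/
def IsEffectiveModel (W : TotalPair G) : Prop :=
  ∃ d : ℕ → Set G, W.IsWeaklyEffectiveModel d ∧
    (∀ (n : ℕ) (es : List (Set G)), (∀ X ∈ es, IsDecidableElement d X) →
      IsDecidableElement d (es.foldl W.ap (d n))) ∧
    ∀ f : Set G → Set G, ScottContinuous f →
      ComputablePred (fun p : ℕ × ℕ => d p.2 ⊆ f (d p.1)) → IsDecidableElement d (W.abs f)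

end TotalPair

end GraphModel

namespace GraphModel

/-! ### Computability of bounded quantifiers over lists -/

section Quantifiers

variable {α β : Type*} [Primcodable α] [Primcodable β]

theorem _root_.PrimrecPred.forall_mem_list_of {f : α → List β} {p : α → β → Prop}
    (hf : Primrec f) (hp : PrimrecRel p) : PrimrecPred fun a => ∀ b ∈ f a, p a b :=
  (PrimrecRel.comp (PrimrecRel.forall_mem_list hp.swap) hf Primrec.id).of_eq fun _ => Iff.rfl

theorem _root_.PrimrecPred.exists_mem_list_of {f : α → List β} {p : α → β → Prop}
    (hf : Primrec f) (hp : PrimrecRel p) : PrimrecPred fun a => ∃ b ∈ f a, p a b :=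
  (PrimrecRel.comp (PrimrecRel.exists_mem_list hp.swap) hf Primrec.id).of_eq fun _ => Iff.rfl

theorem _root_.PrimrecPred.imp {p q : α → Prop} (hp : PrimrecPred p) (hq : PrimrecPred q) :
    PrimrecPred fun a => p a → q a :=
  (hp.not.or hq).of_eq fun _ => imp_iff_not_or.symm

theorem _root_.PrimrecPred.iff {p q : α → Prop} (hp : PrimrecPred p) (hq : PrimrecPred q) :
    PrimrecPred fun a => p a ↔ q a :=
  ((hp.imp hq).and (hq.imp hp)).of_eq fun _ => iff_def.symm

theorem _root_.PrimrecPred.mem_list [DecidableEq β] {f : α → List β} {g : α → β}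
    (hf : Primrec f) (hg : Primrec g) : PrimrecPred fun a => g a ∈ f a :=
  (PrimrecPred.exists_mem_list_of (p := fun a b => b = g a) hf
    (PrimrecRel.comp₂ Primrec.eq Primrec₂.right (hg.comp₂ Primrec₂.left))).of_eq fun a => by simp

/-- A computable predicate may be quantified universally over a computable list. -/
theorem _root_.ComputablePred.forall_mem_list_of {f : α → List β} {p : α × β → Prop}
    (hf : Computable f) (hp : ComputablePred p) : ComputablePred fun a => ∀ b ∈ f a, p (a, b) := by
  classical
  have hp' : Computable fun q : α × β => decide (p q) := hp.decide
  -- `g a n` tests the first `n` entries of `f a`. The default `true` stands for an index out of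
  -- range, which does not occur while `n` is at most the length.
  let g : α → ℕ → Bool := fun a n =>
    Nat.rec true (fun m r => r && ((f a)[m]?.map fun b => decide (p (a, b))).getD true) n
  have hg : Computable fun a => g a (f a).length := by
    refine Computable.nat_rec (h := fun a (q : ℕ × Bool) =>
      q.2 && ((f a)[q.1]?.map fun b => decide (p (a, b))).getD true)
      (Computable.list_length.comp hf) (Computable.const true) ?_
    refine Primrec.and.to_comp.comp (α := α × ℕ × Bool) (Computable.snd.comp Computable.snd) ?_
    refine Computable.option_getD (Computable.option_map ?_ ?_) (Computable.const true)
    · exact Computable.list_getElem?.comp (hf.comp Computable.fst)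
        (Computable.fst.comp Computable.snd)
    · exact (hp'.comp ((Computable.fst.comp Computable.fst).pair Computable.snd)).to₂
  have key : ∀ a n, n ≤ (f a).length → (g a n = true ↔ ∀ b ∈ (f a).take n, p (a, b)) := by
    intro a n
    induction n with
    | zero => intro _; simp [g]
    | succ n ih =>
      intro hn
      have e : g a (n + 1) = (g a n && ((f a)[n]?.map fun b => decide (p (a, b))).getD true) := rfl
      have hn' : n < (f a).length := hn
      rw [e, Bool.and_eq_true, ih hn'.le, ← List.take_concat_get' _ _ hn',
        List.getElem?_eq_getElem hn', List.forall_mem_append]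
      simp
  refine ComputablePred.computable_iff.2 ⟨_, hg, funext fun a => propext ?_⟩
  rw [key a _ le_rfl, List.take_length]

theorem _root_.ComputablePred.comp {p : β → Prop} (hp : ComputablePred p) {f : α → β}
    (hf : Computable f) : ComputablePred fun a => p (f a) := by
  classical exact ⟨inferInstance, hp.decide.comp hf⟩

end Quantifiers

theorem lookup_eq_some_iff {α β : Type*} [BEq α] [LawfulBEq α] {T : List (α × β)}
    (hT : ∀ t ∈ T, ∀ s ∈ T, t.1 = s.1 → t.2 = s.2) (q : α) (y : β) :
    T.lookup q = some y ↔ (q, y) ∈ T := by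
  induction T with
  | nil => simp
  | cons t T ih =>
    obtain ⟨a, b⟩ := t
    have ih := ih fun t ht s hs => hT t (List.mem_cons_of_mem _ ht) s (List.mem_cons_of_mem _ hs)
    rw [List.lookup_cons]
    by_cases h : q = a
    · subst h
      simp only [beq_self_eq_true, List.mem_cons, Prod.mk.injEq, true_and]
      refine ⟨fun h => Or.inl (Option.some.inj h).symm, ?_⟩
      rintro (rfl | h)
      · rfl
      · exact congrArg some (hT (q, b) (by simp) (q, y) (by simp [h]) rfl)
    · have : (q == a) = false := by simpa using h
      simp [this, ih, h]

/-! ### Coding of finite sets of natural numbers -/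

/-- The elements of the finite set coded by `c`: the positions of the binary digits `1` of `c`. -/
def bits (c : ℕ) : List ℕ := (List.range c).filter fun i => c / 2 ^ i % 2 = 1

/-- The code of a finite set of natural numbers. -/
def code (a : Finset ℕ) : ℕ := ∑ i ∈ a, 2 ^ i

/-- A digit `1` at position `i` forces `2 ^ i ≤ c`, hence `i < c`, so the search bound in `bits`
loses nothing. -/
theorem mem_bits_iff {c i : ℕ} : i ∈ bits c ↔ i ∈ c.bitIndices := by
  simp only [bits, List.mem_filter, List.mem_range, decide_eq_true_eq, Nat.mem_bitIndices,
    Nat.testBit_eq_decide_div_mod_eq, and_iff_right_iff_imp]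
  intro h
  by_contra hc
  have : c < 2 ^ i := (not_lt.1 hc).trans_lt Nat.lt_two_pow_self
  simp [Nat.div_eq_of_lt this] at h

theorem lt_of_mem_bits {c i : ℕ} (h : i ∈ bits c) : i < c :=
  List.mem_range.1 (List.mem_filter.1 h).1

theorem toFinset_bits (c : ℕ) : (bits c).toFinset = c.bitIndices.toFinset := by
  ext; simp only [List.mem_toFinset, mem_bits_iff]

@[simp] theorem toFinset_bits_code (a : Finset ℕ) : (bits (code a)).toFinset = a := by
  rw [toFinset_bits, code, Finset.toFinset_bitIndices_sum_two_pow]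

@[simp] theorem code_toFinset_bits (c : ℕ) : code (bits c).toFinset = c := by
  rw [toFinset_bits, code, Finset.sum_toFinset_bitIndices_two_pow]

@[simp] theorem mem_bits_code {a : Finset ℕ} {i : ℕ} : i ∈ bits (code a) ↔ i ∈ a := by
  rw [← List.mem_toFinset, toFinset_bits_code]

theorem code_injective : Function.Injective code := fun a b h => by
  rw [← toFinset_bits_code a, h, toFinset_bits_code]

theorem bits_ext {c c' : ℕ} (h : ∀ i, i ∈ bits c ↔ i ∈ bits c') : c = c' := by
  rw [← code_toFinset_bits c, ← code_toFinset_bits c']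
  congr 1
  ext i
  simpa using h i

theorem primrec_pow : Primrec₂ fun m n : ℕ => m ^ n := Primrec₂.unpaired'.1 Nat.Primrec.pow

theorem primrec_bits : Primrec bits := by
  have hR : PrimrecRel fun c i : ℕ => c / 2 ^ i % 2 = 1 :=
    PrimrecRel.comp Primrec.eq (Primrec.nat_mod.comp (Primrec.nat_div.comp Primrec.fst
      (primrec_pow.comp (Primrec.const 2) Primrec.snd)) (Primrec.const 2)) (Primrec.const 1)
  have : Primrec fun c : ℕ => (List.range c).filterMap
      fun i => if c / 2 ^ i % 2 = 1 then some i else none :=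
    Primrec.listFilterMap Primrec.list_range
      (Primrec.ite hR (Primrec.option_some.comp Primrec.snd) (Primrec.const none))
  refine this.of_eq fun c => ?_
  rw [bits, ← List.filterMap_eq_filter]
  congr 1
  funext i
  simp [Option.guard]

theorem primrec_code_toFinset : Primrec fun l : List ℕ => code l.toFinset := by
  have : Primrec fun l : List ℕ =>
      -- Entries already recorded are skipped, since a repeated power of two would produce a carry.
      l.foldr (fun i c => if i ∈ bits c then c else 2 ^ i + c) 0 := by
    refine Primrec.list_foldr (α := List ℕ) (σ := ℕ) Primrec.id (Primrec.const 0)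
      (h := fun _ p => if p.1 ∈ bits p.2 then p.2 else 2 ^ p.1 + p.2) ?_
    refine Primrec.ite (α := List ℕ × ℕ × ℕ)
      (PrimrecPred.mem_list (α := List ℕ × ℕ × ℕ) (primrec_bits.comp (Primrec.snd.comp Primrec.snd))
      (Primrec.fst.comp Primrec.snd)) (Primrec.snd.comp Primrec.snd) ?_
    exact Primrec.nat_add.comp (primrec_pow.comp (Primrec.const 2) (Primrec.fst.comp Primrec.snd))
      (Primrec.snd.comp Primrec.snd)
  refine this.of_eq fun l => ?_
  induction l with
  | nil => simp [code]
  | cons i l ih =>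
    rw [List.foldr_cons, ih, List.toFinset_cons]
    simp only [mem_bits_code]
    split_ifs with h
    · rw [Finset.insert_eq_of_mem h]
    · rw [code, code, Finset.sum_insert h]

/-! ### Tables of finite partial pairs -/

/-- A table of a finite partial pair: the list of the elements of the carrier and the list of the
entries `((a, α), j (a, α))`, where the finite set `a` is given by its code. -/
abbrev Table : Type := List ℕ × List ((ℕ × ℕ) × ℕ)

/-- The table describes a partial pair. -/
def Table.Valid (T : Table) : Prop :=
  T.1 ≠ [] ∧
    (∀ t ∈ T.2, (∀ i ∈ bits t.1.1, i ∈ T.1) ∧ t.1.2 ∈ T.1 ∧ t.2 ∈ T.1) ∧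
    ∀ t ∈ T.2, ∀ s ∈ T.2, t.1 = s.1 ↔ t.2 = s.2

theorem Table.primrecPred_valid : PrimrecPred Table.Valid := by
  refine PrimrecPred.and ?_ (PrimrecPred.and ?_ ?_)
  · exact (PrimrecRel.comp Primrec.eq Primrec.fst (Primrec.const [])).not
  · refine PrimrecPred.forall_mem_list_of Primrec.snd ?_
    refine PrimrecPred.primrecRel (p := fun q : Table × ((ℕ × ℕ) × ℕ) =>
      (∀ i ∈ bits q.2.1.1, i ∈ q.1.1) ∧ q.2.1.2 ∈ q.1.1 ∧ q.2.2 ∈ q.1.1) ?_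
    have h : Primrec fun q : Table × ((ℕ × ℕ) × ℕ) => q.1.1 := Primrec.fst.comp Primrec.fst
    refine PrimrecPred.and ?_ (PrimrecPred.and ?_ ?_)
    · refine PrimrecPred.forall_mem_list_of (p := fun (q : Table × ((ℕ × ℕ) × ℕ)) (i : ℕ) => i ∈ q.1.1)
        (primrec_bits.comp (Primrec.fst.comp (Primrec.fst.comp Primrec.snd))) ?_
      exact PrimrecPred.primrecRel (PrimrecPred.mem_list (h.comp Primrec.fst) Primrec.snd)
    · exact PrimrecPred.mem_list h (Primrec.snd.comp (Primrec.fst.comp Primrec.snd))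
    · exact PrimrecPred.mem_list h (Primrec.snd.comp Primrec.snd)
  · refine PrimrecPred.forall_mem_list_of Primrec.snd ?_
    refine PrimrecPred.primrecRel (p := fun q : Table × ((ℕ × ℕ) × ℕ) =>
      ∀ s ∈ q.1.2, q.2.1 = s.1 ↔ q.2.2 = s.2) ?_
    refine PrimrecPred.forall_mem_list_of
      (p := fun (q : Table × ((ℕ × ℕ) × ℕ)) (s : (ℕ × ℕ) × ℕ) => (q.2.1 = s.1 ↔ q.2.2 = s.2))
      (Primrec.snd.comp Primrec.fst) ?_
    refine PrimrecPred.primrecRel (p := fun r : (Table × ((ℕ × ℕ) × ℕ)) × ((ℕ × ℕ) × ℕ) =>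
      (r.1.2.1 = r.2.1 ↔ r.1.2.2 = r.2.2)) ?_
    exact PrimrecPred.iff
      (PrimrecRel.comp Primrec.eq (Primrec.fst.comp (Primrec.snd.comp Primrec.fst))
        (Primrec.fst.comp Primrec.snd))
      (PrimrecRel.comp Primrec.eq (Primrec.snd.comp (Primrec.snd.comp Primrec.fst))
        (Primrec.snd.comp Primrec.snd))

open Classical in
/-- An enumeration of the valid tables. -/
noncomputable def table (k : ℕ) : Table :=
  if Table.Valid (Denumerable.ofNat Table k) then Denumerable.ofNat Table k else ([0], [])

theorem primrec_table : Primrec table := by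
  classical
  exact Primrec.ite (Table.primrecPred_valid.comp (Primrec.ofNat Table)) (Primrec.ofNat Table)
    (Primrec.const _)

theorem valid_table (k : ℕ) : (table k).Valid := by
  rw [table]
  split_ifs with h
  · exact h
  -- The default table describes the one-point pair with the empty map.
  · exact ⟨by simp, by simp, by simp⟩

theorem exists_table_eq {T : Table} (hT : T.Valid) : ∃ k, table k = T :=
  ⟨Encodable.encode T, by rw [table, Denumerable.ofNat_encode, if_pos hT]⟩

/-- The finite partial pair described by the `k`-th table. -/
noncomputable def finitePair (k : ℕ) : PartialPair ℕ where
  carrier := {x | x ∈ (table k).1}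
  nonempty := List.exists_mem_of_ne_nil _ (valid_table k).1
  j := fun p => ((table k).2.lookup (code p.1, p.2) : Option ℕ)
  mem_carrier := by
    intro a α y h
    rw [Part.mem_ofOption, Option.mem_def, lookup_eq_some_iff fun t ht s hs e =>
      ((valid_table k).2.2 t ht s hs).1 e] at h
    obtain ⟨h1, h2, h3⟩ := (valid_table k).2.1 _ h
    exact ⟨fun i hi => h1 i (mem_bits_code.2 hi), h2, h3⟩
  inj := by
    rintro ⟨a, α⟩ ⟨b, β⟩ y h h'
    rw [Part.mem_ofOption, Option.mem_def, lookup_eq_some_iff fun t ht s hs e =>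
      ((valid_table k).2.2 t ht s hs).1 e] at h h'
    have := ((valid_table k).2.2 _ h _ h').2 rfl
    rw [Prod.mk.injEq] at this
    exact Prod.ext (code_injective this.1) this.2

theorem mem_finitePair_carrier {k x : ℕ} : x ∈ (finitePair k).carrier ↔ x ∈ (table k).1 := Iff.rfl

theorem mem_finitePair_j {k : ℕ} {p : Finset ℕ × ℕ} {y : ℕ} :
    y ∈ (finitePair k).j p ↔ ((code p.1, p.2), y) ∈ (table k).2 := by
  rw [← lookup_eq_some_iff fun t ht s hs e => ((valid_table k).2.2 t ht s hs).1 e,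
    ← Option.mem_def, ← Part.mem_ofOption, finitePair]

theorem isEffectiveNumeration_finitePair : PartialPair.IsEffectiveNumeration finitePair where
  finite k := (table k).1.finite_toSet
  surjective B hB := by
    classical
    obtain ⟨l, hl⟩ : ∃ l : List ℕ, ∀ x, x ∈ l ↔ x ∈ B.carrier :=
      ⟨hB.toFinset.toList, fun x => by simp⟩
    -- As `B.j` is injective, an entry of its graph is determined by its value, and the values lie
    -- in the finite carrier.
    have hfin : {t : (ℕ × ℕ) × ℕ | t.2 ∈ B.j ((bits t.1.1).toFinset, t.1.2)}.Finite := by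
      refine Set.Finite.of_finite_image (f := Prod.snd) (hB.subset ?_) ?_
      · rintro _ ⟨t, ht, rfl⟩
        exact (B.mem_carrier _ _ _ ht).2.2
      · rintro ⟨⟨c, α⟩, y⟩ ht ⟨⟨c', α'⟩, y'⟩ ht' (rfl : y = y')
        have := B.inj _ _ _ ht ht'
        simp only [Prod.mk.injEq] at this ⊢
        refine ⟨⟨?_, this.2⟩, trivial⟩
        rw [← code_toFinset_bits c, this.1, code_toFinset_bits]
    obtain ⟨m, hm⟩ : ∃ m : List ((ℕ × ℕ) × ℕ), ∀ t, t ∈ m ↔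
        t.2 ∈ B.j ((bits t.1.1).toFinset, t.1.2) := ⟨hfin.toFinset.toList, fun x => by simp⟩
    have hv : Table.Valid (l, m) := by
      refine ⟨?_, ?_, ?_⟩
      · obtain ⟨x, hx⟩ := B.nonempty
        exact List.ne_nil_of_mem ((hl x).2 hx)
      · intro t ht
        obtain ⟨h1, h2, h3⟩ := B.mem_carrier _ _ _ ((hm t).1 ht)
        exact ⟨fun i hi => (hl i).2 (h1 (by simpa using hi)), (hl _).2 h2, (hl _).2 h3⟩
      · rintro ⟨⟨c, α⟩, y⟩ ht ⟨⟨c', α'⟩, y'⟩ ht'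
        have ht := (hm _).1 ht
        have ht' := (hm _).1 ht'
        constructor
        · rintro h
          rw [Prod.mk.injEq] at h
          obtain ⟨rfl, rfl⟩ := h
          exact Part.mem_unique ht ht'
        · rintro (rfl : y = y')
          have := B.inj _ _ _ ht ht'
          simp only [Prod.mk.injEq] at this ⊢
          refine ⟨?_, this.2⟩
          rw [← code_toFinset_bits c, this.1, code_toFinset_bits]
    obtain ⟨k, hk⟩ := exists_table_eq hv
    refine ⟨k, ?_⟩
    have h1 : (finitePair k).carrier = B.carrier := by
      ext x
      rw [mem_finitePair_carrier, hk, hl]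
    have h2 : (finitePair k).j = B.j := by
      funext p
      refine Part.ext fun y => ?_
      rw [mem_finitePair_j, hk, hm]
      simp
    cases hB' : finitePair k
    cases B
    simp_all
  effective := by
    refine ⟨fun k => ((table k).1, (table k).2.map fun t => ((bits t.1.1, t.1.2), t.2)), ?_,
      fun k x => Iff.rfl, fun k a α y => ?_⟩
    · refine Primrec.to_comp (Primrec.pair (Primrec.fst.comp primrec_table)
        (Primrec.list_map (Primrec.snd.comp primrec_table) ?_))
      exact Primrec.pair (Primrec.pair
        (primrec_bits.comp (Primrec.fst.comp (Primrec.fst.comp Primrec.snd)))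
        (Primrec.snd.comp (Primrec.fst.comp Primrec.snd))) (Primrec.snd.comp Primrec.snd)
    · rw [mem_finitePair_j]
      simp only [List.mem_map, Prod.mk.injEq]
      constructor
      · intro h
        exact ⟨bits (code a), by simp, _, h, ⟨rfl, rfl⟩, rfl⟩
      · rintro ⟨l, rfl, ⟨⟨c, β⟩, z⟩, h, ⟨rfl, rfl⟩, rfl⟩
        simpa using h

/-! ### Codes of the elements of the free completion -/

/-- The code of the element `x` of the `k`-th finite partial pair. -/
def atomCode (k x : ℕ) : ℕ := 2 * Nat.pair k x

/-- The code of the formal pair of the finite set coded by `c` and the element coded by `α`. -/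
def formalPair (c α : ℕ) : ℕ := 2 * Nat.pair c α + 1

/-- The two numbers from which a code is built. -/
def parts (n : ℕ) : ℕ × ℕ := Nat.unpair (n / 2)

@[simp] theorem parts_atomCode (k x : ℕ) : parts (atomCode k x) = (k, x) := by
  simp [parts, atomCode]

@[simp] theorem parts_formalPair (c α : ℕ) : parts (formalPair c α) = (c, α) := by
  rw [parts, formalPair, show (2 * Nat.pair c α + 1) / 2 = Nat.pair c α by omega, Nat.unpair_pair]

@[simp] theorem atomCode_mod_two (k x : ℕ) : atomCode k x % 2 = 0 := by simp [atomCode]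

@[simp] theorem formalPair_mod_two (c α : ℕ) : formalPair c α % 2 = 1 := by
  rw [formalPair]; omega

theorem atomCode_parts {n : ℕ} (h : n % 2 = 0) : atomCode (parts n).1 (parts n).2 = n := by
  rw [atomCode, parts, Nat.pair_unpair]; omega

theorem formalPair_parts {n : ℕ} (h : n % 2 ≠ 0) : formalPair (parts n).1 (parts n).2 = n := by
  rw [formalPair, parts, Nat.pair_unpair]; omega

theorem atomCode_inj {k x l y : ℕ} : atomCode k x = atomCode l y ↔ k = l ∧ x = y := by
  refine ⟨fun h => ?_, by rintro ⟨rfl, rfl⟩; rfl⟩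
  have := congrArg parts h
  simpa using this

theorem lt_of_mem_bits_parts {n i : ℕ} (hi : i ∈ bits (parts n).1) : i < n :=
  (lt_of_mem_bits hi).trans_le ((Nat.unpair_left_le _).trans (Nat.div_le_self _ _))

theorem parts_snd_lt {n : ℕ} (hn : n % 2 ≠ 0) : (parts n).2 < n :=
  (Nat.unpair_right_le _).trans_lt (by omega)

theorem primrec_parts : Primrec parts :=
  Primrec.unpair.comp (Primrec.nat_div.comp Primrec.id (Primrec.const 2))

theorem primrec_atomCode : Primrec₂ atomCode := Primrec.nat_double.comp Primrec₂.natPair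

theorem primrec_formalPair : Primrec₂ formalPair := Primrec.nat_double_succ.comp Primrec₂.natPair

theorem primrecPred_even {α : Type*} [Primcodable α] {f : α → ℕ} (hf : Primrec f) :
    PrimrecPred fun a => f a % 2 = 0 :=
  PrimrecRel.comp Primrec.eq (Primrec.nat_mod.comp hf (Primrec.const 2)) (Primrec.const 0)

/-- The code of the copy of the finite set coded by `c` inside of the `k`-th component. -/
def shiftCode (k c : ℕ) : ℕ := code ((bits c).map (atomCode k)).toFinset

@[simp] theorem mem_bits_shiftCode {k c i : ℕ} :
    i ∈ bits (shiftCode k c) ↔ ∃ x ∈ bits c, atomCode k x = i := by simp [shiftCode]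

theorem shiftCode_injective (k : ℕ) : Function.Injective (shiftCode k) := by
  intro c c' h
  refine bits_ext fun i => ?_
  have := mem_bits_shiftCode (k := k) (c := c) (i := atomCode k i)
  rw [h, mem_bits_shiftCode] at this
  simpa [atomCode_inj] using this.symm

/-- The table of the copy of the `k`-th finite partial pair inside of the disjoint union. -/
noncomputable def atomTable (k : ℕ) : List ((ℕ × ℕ) × ℕ) :=
  (table k).2.map fun t => ((shiftCode k t.1.1, atomCode k t.1.2), atomCode k t.2)

theorem mem_atomTable {k c α y : ℕ} : ((c, α), y) ∈ atomTable k ↔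
    ∃ c₀ α₀ y₀, ((c₀, α₀), y₀) ∈ (table k).2 ∧
      shiftCode k c₀ = c ∧ atomCode k α₀ = α ∧ atomCode k y₀ = y := by
  simp [atomTable, and_assoc]

/-- Validity of the table survives the injective renaming: one direction makes the table a function,
which justifies `lookup`, and the other makes it injective, which justifies `lookup` in the swapped
table. -/
theorem atomTable_fst_eq_iff {k : ℕ} {t s : (ℕ × ℕ) × ℕ} (ht : t ∈ atomTable k)
    (hs : s ∈ atomTable k) : t.1 = s.1 ↔ t.2 = s.2 := by
  obtain ⟨t', ht', rfl⟩ := List.mem_map.1 ht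
  obtain ⟨s', hs', rfl⟩ := List.mem_map.1 hs
  have := (valid_table k).2.2 t' ht' s' hs'
  simpa [atomCode_inj, (shiftCode_injective k).eq_iff, Prod.ext_iff] using this

theorem primrec_atomTable : Primrec atomTable := by
  refine Primrec.list_map (Primrec.snd.comp primrec_table) ?_
  have h1 : Primrec fun q : ℕ × ((ℕ × ℕ) × ℕ) => bits q.2.1.1 :=
    primrec_bits.comp (Primrec.fst.comp (Primrec.fst.comp Primrec.snd))
  have h2 : Primrec fun q : ℕ × ((ℕ × ℕ) × ℕ) => shiftCode q.1 q.2.1.1 :=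
    primrec_code_toFinset.comp (Primrec.list_map h1
      (primrec_atomCode.comp (Primrec.fst.comp Primrec.fst) Primrec.snd))
  exact Primrec.pair (Primrec.pair h2
    (primrec_atomCode.comp Primrec.fst (Primrec.snd.comp (Primrec.fst.comp Primrec.snd))))
    (primrec_atomCode.comp Primrec.fst (Primrec.snd.comp Primrec.snd))

/-- The partial map of the disjoint union, on codes. -/
noncomputable def atomMap (p : ℕ × ℕ) : Option ℕ := (atomTable (parts p.2).1).lookup p

/-- The total map of the free completion, on codes. -/
noncomputable def webMap (p : ℕ × ℕ) : ℕ := (atomMap p).getD (formalPair p.1 p.2)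

/-- The partial inverse of the total map of the free completion, on codes. -/
noncomputable def webInv (n : ℕ) : Option (ℕ × ℕ) :=
  if n % 2 = 0 then ((atomTable (parts n).1).map Prod.swap).lookup n else some (parts n)

/-- The second argument of an entry is an atom of the component that the entry belongs to, so the
right table can be read off it. If `p.2` is a formal pair, the table consulted is arbitrary but has
no entry for `p`. -/
theorem atomMap_eq_some {p : ℕ × ℕ} {y : ℕ} :
    atomMap p = some y ↔ ∃ k, (p, y) ∈ atomTable k := by
  rw [atomMap, lookup_eq_some_iff fun t ht s hs e => (atomTable_fst_eq_iff ht hs).1 e]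
  refine ⟨fun h => ⟨_, h⟩, ?_⟩
  rintro ⟨k, h⟩
  obtain ⟨c₀, α₀, y₀, -, -, h', -⟩ := mem_atomTable.1 h
  rwa [← h', parts_atomCode]

theorem webInv_eq_some {p : ℕ × ℕ} {y : ℕ} (hy : y % 2 = 0) :
    webInv y = some p ↔ atomMap p = some y := by
  rw [webInv, if_pos hy, lookup_eq_some_iff, atomMap_eq_some]
  · simp only [List.mem_map, Prod.exists, Prod.swap_prod_mk, Prod.mk.injEq]
    constructor
    · rintro ⟨a, b, c, h, rfl, rfl⟩
      exact ⟨_, h⟩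
    · rintro ⟨k, h⟩
      obtain ⟨c₀, α₀, y₀, -, -, -, h'⟩ := mem_atomTable.1 h
      refine ⟨p.1, p.2, y, ?_, rfl, rfl⟩
      rwa [← h', parts_atomCode, h']
  · intro t ht s hs e
    obtain ⟨t', ht', rfl⟩ := List.mem_map.1 ht
    obtain ⟨s', hs', rfl⟩ := List.mem_map.1 hs
    exact (atomTable_fst_eq_iff ht' hs').2 e

theorem webMap_of_atomMap {p : ℕ × ℕ} {y : ℕ} (h : atomMap p = some y) : webMap p = y := by
  rw [webMap, h, Option.getD_some]

theorem webMap_of_atomMap_eq_none {p : ℕ × ℕ} (h : atomMap p = none) :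
    webMap p = formalPair p.1 p.2 := by
  rw [webMap, h, Option.getD_none]

theorem atomMap_spec {p : ℕ × ℕ} {y : ℕ} (h : atomMap p = some y) :
    ∃ k c₀ α₀ y₀, ((c₀, α₀), y₀) ∈ (table k).2 ∧
      p = (shiftCode k c₀, atomCode k α₀) ∧ y = atomCode k y₀ := by
  obtain ⟨k, hk⟩ := atomMap_eq_some.1 h
  obtain ⟨c₀, α₀, y₀, h0, h1, h2, h3⟩ := mem_atomTable.1 hk
  exact ⟨k, c₀, α₀, y₀, h0, Prod.ext h1.symm h2.symm, h3.symm⟩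

theorem atomMap_of_mem_table {k c α y : ℕ} (h : ((c, α), y) ∈ (table k).2) :
    atomMap (shiftCode k c, atomCode k α) = some (atomCode k y) :=
  atomMap_eq_some.2 ⟨k, mem_atomTable.2 ⟨c, α, y, h, rfl, rfl, rfl⟩⟩

-- Parity tells the two kinds of value apart: values of `atomMap` are even and are inverted by the
-- swapped table, formal pairs are odd and are inverted by `parts`.
@[simp] theorem webInv_webMap (p : ℕ × ℕ) : webInv (webMap p) = some p := by
  rcases h : atomMap p with _ | y
  · rw [webMap_of_atomMap_eq_none h, webInv, if_neg (by simp), parts_formalPair]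
  · obtain ⟨k, c₀, α₀, y₀, -, -, rfl⟩ := atomMap_spec h
    rwa [webMap_of_atomMap h, webInv_eq_some (by simp)]

theorem webMap_injective : Function.Injective webMap := fun p q h => by
  simpa using congrArg webInv h

theorem primrec_lookup {α β : Type*} [Primcodable α] [Primcodable β] [inst : BEq α]
    [LawfulBEq α] : Primrec₂ (List.lookup : α → List (α × β) → Option β) := by
  classical
  rw [lawful_beq_subsingleton inst instBEqOfDecidableEq]
  exact Primrec.listLookup

theorem primrec_atomMap : Primrec atomMap :=
  primrec_lookup.comp Primrec.id
    (primrec_atomTable.comp (Primrec.fst.comp (primrec_parts.comp Primrec.snd)))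

theorem primrec_webMap : Primrec webMap :=
  Primrec.option_getD.comp primrec_atomMap (primrec_formalPair.comp Primrec.fst Primrec.snd)

theorem primrec_webInv : Primrec webInv :=
  Primrec.ite (primrecPred_even Primrec.id)
    (primrec_lookup.comp Primrec.id (Primrec.list_map
      (primrec_atomTable.comp (Primrec.fst.comp primrec_parts))
      (Primrec.pair (Primrec.snd.comp Primrec.snd) (Primrec.fst.comp Primrec.snd))))
    (Primrec.option_some.comp primrec_parts)

/-- The codes of the elements of the free completion. -/
inductive IsPoint : ℕ → Prop
  | atom {k x : ℕ} : x ∈ (table k).1 → IsPoint (atomCode k x)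
  | pair {c α : ℕ} : (∀ i ∈ bits c, IsPoint i) → IsPoint α → atomMap (c, α) = none →
      IsPoint (formalPair c α)

theorem isPoint_iff_of_even {n : ℕ} (hn : n % 2 = 0) :
    IsPoint n ↔ (parts n).2 ∈ (table (parts n).1).1 := by
  constructor
  · rintro (h | h)
    · simpa using h
    · simp at hn
  · intro h
    rw [← atomCode_parts hn]
    exact .atom h

theorem isPoint_iff_of_odd {n : ℕ} (hn : n % 2 ≠ 0) :
    IsPoint n ↔ (∀ i ∈ (parts n).2 :: bits (parts n).1, IsPoint i) ∧
      atomMap (parts n) = none := by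
  rw [List.forall_mem_cons]
  constructor
  · rintro (h | ⟨h1, h2, h3⟩)
    · simp at hn
    · simpa using ⟨⟨h2, h1⟩, h3⟩
  · rintro ⟨⟨h2, h1⟩, h3⟩
    rw [← formalPair_parts hn]
    exact .pair h1 h2 h3

/-- Course-of-values recursion: for odd `n` the answer depends on the answers for the second part of
`n` and for the elements of the set coded by the first, all smaller than `n`; for even `n` the table
decides. -/
theorem primrecPred_isPoint : PrimrecPred IsPoint := by
  classical
  let g : ℕ → List Bool → Option Bool := fun n r =>
    some (if n % 2 = 0 then decide ((parts n).2 ∈ (table (parts n).1).1)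
      else decide ((∀ b ∈ r, b = true) ∧ atomMap (parts n) = none))
  refine Primrec.primrecPred (Primrec.nat_omega_rec' (fun n => decide (IsPoint n)) (m := id)
    (l := fun n => if n % 2 = 0 then [] else (parts n).2 :: bits (parts n).1) (g := g)
    Primrec.id ?_ ?_ ?_ ?_)
  · exact Primrec.ite (primrecPred_even Primrec.id) (Primrec.const [])
      (Primrec.list_cons.comp (Primrec.snd.comp primrec_parts)
        (primrec_bits.comp (Primrec.fst.comp primrec_parts)))
  · have hp : Primrec fun q : ℕ × List Bool => parts q.1 := primrec_parts.comp Primrec.fst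
    refine Primrec.option_some.comp (Primrec.ite (primrecPred_even Primrec.fst) ?_ ?_)
    · exact (PrimrecPred.mem_list (Primrec.fst.comp (primrec_table.comp (Primrec.fst.comp hp)))
        (Primrec.snd.comp hp)).decide
    · refine PrimrecPred.decide (PrimrecPred.and ?_ ?_)
      · exact PrimrecPred.forall_mem_list_of Primrec.snd
          (PrimrecRel.comp₂ Primrec.eq Primrec₂.right (Primrec₂.const true))
      · exact PrimrecRel.comp Primrec.eq (primrec_atomMap.comp hp) (Primrec.const none)
  · intro n i hi
    split_ifs at hi with hn
    · simp at hi
    · rcases List.mem_cons.1 hi with rfl | hi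
      · exact parts_snd_lt hn
      · exact lt_of_mem_bits_parts hi
  · intro n
    simp only [g]
    congr 1
    split_ifs with hn
    · simp only [isPoint_iff_of_even hn]
    · rw [decide_eq_decide, isPoint_iff_of_odd hn, List.forall_mem_map]
      simp only [decide_eq_true_eq]

theorem isPoint_webMap {c α : ℕ} (hc : ∀ i ∈ bits c, IsPoint i) (hα : IsPoint α) :
    IsPoint (webMap (c, α)) := by
  rcases h : atomMap (c, α) with _ | y
  · rw [webMap_of_atomMap_eq_none h]
    exact .pair hc hα h
  · rw [webMap_of_atomMap h]
    obtain ⟨k, c₀, α₀, y₀, h0, -, rfl⟩ := atomMap_spec h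
    exact .atom ((valid_table k).2.1 _ h0).2.2

/-- That `n` is a point matters for odd `n`: it excludes formal pairs whose parts lie in the domain
of `atomMap`, which `webMap` sends to an atom instead. -/
theorem webInv_spec {n : ℕ} (hn : IsPoint n) {p : ℕ × ℕ} (h : webInv n = some p) :
    (∀ i ∈ bits p.1, IsPoint i) ∧ IsPoint p.2 ∧ webMap p = n := by
  by_cases h2 : n % 2 = 0
  · rw [webInv_eq_some h2] at h
    refine ⟨?_, ?_, webMap_of_atomMap h⟩ <;>
      obtain ⟨k, c₀, α₀, y₀, h0, rfl, -⟩ := atomMap_spec h <;>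
      obtain ⟨h3, h4, -⟩ := (valid_table k).2.1 _ h0
    · intro i hi
      obtain ⟨x, hx, rfl⟩ := mem_bits_shiftCode.1 hi
      exact .atom (h3 x hx)
    · exact .atom h4
  · rw [webInv, if_neg h2, Option.some.injEq] at h
    subst h
    have := (isPoint_iff_of_odd h2).1 hn
    rw [List.forall_mem_cons] at this
    exact ⟨this.1.2, this.1.1, by rw [webMap_of_atomMap_eq_none this.2, formalPair_parts h2]⟩

/-! ### The free completion -/

/-- The carrier of the free completion. -/
abbrev Web : Type := {n : ℕ // IsPoint n}

/-- The code of a finite set of elements of the free completion. -/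
def codeOf (a : Finset Web) : ℕ := code (a.map (Function.Embedding.subtype IsPoint))

theorem mem_bits_codeOf {a : Finset Web} {i : ℕ} :
    i ∈ bits (codeOf a) ↔ ∃ y ∈ a, y.1 = i := by
  simp [codeOf]

theorem val_mem_bits_codeOf {a : Finset Web} {y : Web} : y.1 ∈ bits (codeOf a) ↔ y ∈ a := by
  rw [mem_bits_codeOf]
  exact ⟨fun ⟨z, hz, e⟩ => Subtype.ext e ▸ hz, fun h => ⟨y, h, rfl⟩⟩

theorem codeOf_injective : Function.Injective codeOf :=
  code_injective.comp (Finset.map_injective _)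

theorem exists_codeOf_eq {c : ℕ} (hc : ∀ i ∈ bits c, IsPoint i) : ∃ a, codeOf a = c := by
  classical
  refine ⟨(bits c).toFinset.subtype IsPoint, bits_ext fun i => ?_⟩
  rw [mem_bits_codeOf]
  constructor
  · rintro ⟨y, hy, rfl⟩
    exact List.mem_toFinset.1 (Finset.mem_subtype.1 hy)
  · exact fun hi => ⟨⟨i, hc i hi⟩, Finset.mem_subtype.2 (List.mem_toFinset.2 hi), rfl⟩

theorem isPoint_of_mem_bits_codeOf {a : Finset Web} : ∀ i ∈ bits (codeOf a), IsPoint i := by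
  intro i hi
  obtain ⟨y, -, rfl⟩ := mem_bits_codeOf.1 hi
  exact y.2

/-- The free completion of the disjoint union of the finite partial pairs. -/
noncomputable def web : TotalPair Web where
  infinite := by
    choose x hx using fun k => (finitePair k).nonempty
    refine Infinite.of_injective (fun k => (⟨atomCode k (x k), .atom (hx k)⟩ : Web)) fun k l h => ?_
    exact (atomCode_inj.1 (congrArg Subtype.val h)).1
  i := fun p => ⟨webMap (codeOf p.1, p.2.1), isPoint_webMap isPoint_of_mem_bits_codeOf p.2.2⟩
  inj := by
    rintro ⟨a, α⟩ ⟨b, β⟩ h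
    have := webMap_injective (congrArg Subtype.val h)
    rw [Prod.mk.injEq] at this
    exact Prod.ext (codeOf_injective this.1) (Subtype.ext this.2)

theorem web_i_val (a : Finset Web) (α : Web) : (web.i (a, α)).1 = webMap (codeOf a, α.1) := rfl

theorem webInv_web_i (a : Finset Web) (α : Web) :
    webInv (web.i (a, α)).1 = some (codeOf a, α.1) := by rw [web_i_val, webInv_webMap]

theorem exists_web_i_eq {y : Web} {p : ℕ × ℕ} (h : webInv y.1 = some p) :
    ∃ a α, codeOf a = p.1 ∧ α.1 = p.2 ∧ web.i (a, α) = y := by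
  obtain ⟨h1, h2, h3⟩ := webInv_spec y.2 h
  obtain ⟨a, ha⟩ := exists_codeOf_eq h1
  refine ⟨a, ⟨p.2, h2⟩, ha, rfl, Subtype.ext ?_⟩
  rw [web_i_val, ha, ← h3]

/-- The embedding of the disjoint union of the finite partial pairs into its free completion. -/
noncomputable def atom (q : ℕ × ℕ) : Web :=
  if h : q.2 ∈ (table q.1).1 then ⟨atomCode q.1 q.2, .atom h⟩
  -- An arbitrary value for arguments outside the disjoint union.
  else ⟨_, .atom (finitePair 0).nonempty.choose_spec⟩

theorem atom_val {q : ℕ × ℕ} (h : q ∈ (PartialPair.disjointUnion finitePair).carrier) :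
    (atom q).1 = atomCode q.1 q.2 := by
  rw [atom, dif_pos (show q.2 ∈ (table q.1).1 from h)]

theorem mem_disjointUnion_j {a : Finset (ℕ × ℕ)} {q y : ℕ × ℕ} :
    y ∈ (PartialPair.disjointUnion finitePair).j (a, q) ↔ (∀ r ∈ a, r.1 = q.1) ∧ y.1 = q.1 ∧
      ((code (a.image Prod.snd), q.2), y.2) ∈ (table q.1).2 := by
  simp only [PartialPair.disjointUnion, Part.mem_assert_iff, Part.mem_map_iff, mem_finitePair_j]
  constructor
  · rintro ⟨h, z, hz, rfl⟩
    exact ⟨h, rfl, hz⟩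
  · rintro ⟨h, h1, h2⟩
    exact ⟨h, y.2, h2, Prod.ext h1.symm rfl⟩

theorem atomMap_of_mem_disjointUnion_j {a : Finset (ℕ × ℕ)} {q y : ℕ × ℕ} {b : Finset Web}
    (h : y ∈ (PartialPair.disjointUnion finitePair).j (a, q)) (hb : (b : Set Web) = atom '' a) :
    atomMap (codeOf b, (atom q).1) = some (atom y).1 := by
  obtain ⟨h1, h2, h3⟩ := (PartialPair.disjointUnion finitePair).mem_carrier _ _ _ h
  obtain ⟨h4, h5, h6⟩ := mem_disjointUnion_j.1 h
  have hc : codeOf b = shiftCode q.1 (code (a.image Prod.snd)) := by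
    refine bits_ext fun i => ?_
    simp only [mem_bits_codeOf, mem_bits_shiftCode, mem_bits_code, Finset.mem_image]
    constructor
    · rintro ⟨z, hz, rfl⟩
      rw [← Finset.mem_coe, hb] at hz
      obtain ⟨r, hr, rfl⟩ := hz
      exact ⟨r.2, ⟨r, hr, rfl⟩, by rw [atom_val (h1 hr), h4 r hr]⟩
    · rintro ⟨x, ⟨r, hr, rfl⟩, rfl⟩
      refine ⟨atom r, ?_, by rw [atom_val (h1 hr), h4 r hr]⟩
      rw [← Finset.mem_coe, hb]
      exact ⟨r, hr, rfl⟩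
  rw [hc, atom_val h2, atom_val h3, h5]
  exact atomMap_of_mem_table h6

/-- This matches the side condition in the abstract definition of the stages with the condition
`atomMap (c, α) = none` under which a formal pair is a point. -/
theorem mem_imageDom_iff {b : Finset Web} {β : Web} :
    (b, β) ∈ TotalPair.imageDom (PartialPair.disjointUnion finitePair) atom ↔
      atomMap (codeOf b, β.1) ≠ none := by
  constructor
  · rintro ⟨⟨a, q⟩, hd, hb, rfl⟩
    rw [atomMap_of_mem_disjointUnion_j (Part.get_mem hd) hb]
    exact Option.some_ne_none _
  · intro h
    obtain ⟨y, hy⟩ := Option.ne_none_iff_exists'.1 h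
    obtain ⟨k, c, α, y, h0, h1, -⟩ := atomMap_spec hy
    rw [Prod.mk.injEq] at h1
    have hj : (k, y) ∈ (PartialPair.disjointUnion finitePair).j
        ((bits c).toFinset.image (Prod.mk k), (k, α)) := by
      rw [mem_disjointUnion_j]
      refine ⟨by simp, rfl, ?_⟩
      rw [Finset.image_image, show Prod.snd ∘ Prod.mk k = (id : ℕ → ℕ) from rfl, Finset.image_id,
        code_toFinset_bits]
      exact h0
    obtain ⟨hc1, hc2, -⟩ := (PartialPair.disjointUnion finitePair).mem_carrier _ _ _ hj
    refine ⟨((bits c).toFinset.image (Prod.mk k), (k, α)), Part.dom_iff_mem.2 ⟨_, hj⟩, ?_,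
      Subtype.ext ?_⟩
    · ext z
      simp only [Finset.coe_image, List.coe_toFinset, Set.mem_image, Set.mem_ofPred_eq,
        exists_exists_and_eq_and, Finset.mem_coe]
      rw [← val_mem_bits_codeOf, h1.1, mem_bits_shiftCode]
      refine exists_congr fun x => and_congr_right fun hx => ?_
      have : (k, x) ∈ (PartialPair.disjointUnion finitePair).carrier := hc1 (by simpa using hx)
      rw [Subtype.ext_iff, atom_val this]
    · rw [h1.2, atom_val hc2]

theorem stage_mono {m n : ℕ} (h : m ≤ n) :
    web.stage (PartialPair.disjointUnion finitePair) atom m ⊆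
      web.stage (PartialPair.disjointUnion finitePair) atom n := by
  refine monotone_nat_of_le_succ (fun n => ?_) h
  induction n with
  | zero => exact Set.subset_union_left
  | succ n ih =>
    refine Set.union_subset_union_right _ ?_
    rintro y ⟨a, α, h1, h2, h3⟩
    exact ⟨a, α, h1.trans ih, ih h2, h3⟩

theorem exists_mem_stage {n : ℕ} (hn : IsPoint n) :
    ∃ m, ∀ h, (⟨n, h⟩ : Web) ∈ web.stage (PartialPair.disjointUnion finitePair) atom m := by
  induction hn with
  | @atom k x hx => exact ⟨0, fun h => ⟨(k, x), hx, Subtype.ext (atom_val (q := (k, x)) hx)⟩⟩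
  | @pair c α hc hα hn ihc ihα =>
    choose! f hf using ihc
    obtain ⟨m, hm⟩ := ihα
    obtain ⟨a, rfl⟩ := exists_codeOf_eq hc
    -- One stage beyond a stage that already contains `α` and all elements of `a`.
    refine ⟨max ((bits (codeOf a)).toFinset.sup f) m + 1, fun h =>
      Or.inr ⟨a, ⟨α, hα⟩, ?_, stage_mono (le_max_right _ _) (hm hα), ?_, Subtype.ext ?_⟩⟩
    · intro y hy
      have hy := val_mem_bits_codeOf.2 hy
      exact stage_mono (le_max_of_le_left
        (Finset.le_sup (f := f) (List.mem_toFinset.2 hy))) (hf _ hy y.2)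
    · rw [mem_imageDom_iff]
      exact not_not.2 hn
    · exact (webMap_of_atomMap_eq_none hn).symm

theorem isFreeCompletion_web :
    web.IsFreeCompletion (PartialPair.disjointUnion finitePair) atom where
  injOn q hq r hr h := by
    have := congrArg Subtype.val h
    rw [atom_val hq, atom_val hr, atomCode_inj] at this
    exact Prod.ext this.1 this.2
  extends_j a α y b h hb :=
    Subtype.ext (webMap_of_atomMap (atomMap_of_mem_disjointUnion_j h hb))
  free := by
    rintro ⟨b, β⟩ hq ⟨r, hr, h⟩
    rw [mem_imageDom_iff, not_not] at hq
    have := congrArg Subtype.val h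
    rw [web_i_val, webMap_of_atomMap_eq_none hq, atom_val hr] at this
    -- A formal pair has an odd code, an atom an even one.
    have := congrArg (· % 2) this
    simp at this
  exhausts y := (exists_mem_stage y.2).imp fun _ h => h y.2

/-! ### Effectiveness of the free completion -/

/-- The free completion as a pair on a set of natural numbers. -/
noncomputable def codePair : PartialPair ℕ where
  carrier := {n | IsPoint n}
  nonempty := ⟨_, .atom (finitePair 0).nonempty.choose_spec⟩
  j := fun p => Part.assert ((∀ i ∈ p.1, IsPoint i) ∧ IsPoint p.2) fun _ =>
    Part.some (webMap (code p.1, p.2))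
  mem_carrier := by
    intro a α y h
    obtain ⟨⟨h1, h2⟩, h3⟩ := Part.mem_assert_iff.1 h
    refine ⟨h1, h2, ?_⟩
    rw [Part.mem_some_iff.1 h3]
    exact isPoint_webMap (fun i hi => h1 i (mem_bits_code.1 hi)) h2
  inj := by
    rintro ⟨a, α⟩ ⟨b, β⟩ y h h'
    obtain ⟨-, h⟩ := Part.mem_assert_iff.1 h
    obtain ⟨-, h'⟩ := Part.mem_assert_iff.1 h'
    rw [Part.mem_some_iff] at h h'
    have := webMap_injective (h.symm.trans h')
    rw [Prod.mk.injEq] at this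
    exact Prod.ext (code_injective this.1) this.2

theorem mem_codePair_j {p : Finset ℕ × ℕ} {y : ℕ} : y ∈ codePair.j p ↔
    ((∀ i ∈ p.1, IsPoint i) ∧ IsPoint p.2) ∧ y = webMap (code p.1, p.2) := by
  simp [codePair]

/-- Subtype inclusion is the isomorphism onto `codePair`. The range of the map is decidable because
`webInv` is total recursive and succeeds on a point exactly when the point is a value. -/
theorem isEffective_web : web.toPartialPair.IsEffective := by
  classical
  have hdom : PrimrecPred fun p : List ℕ × ℕ => (∀ i ∈ p.1, IsPoint i) ∧ IsPoint p.2 :=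
    (primrecPred_isPoint.forall_mem_list.comp Primrec.fst).and
      (primrecPred_isPoint.comp Primrec.snd)
  have hmap : Primrec fun p : List ℕ × ℕ => webMap (code p.1.toFinset, p.2) :=
    primrec_webMap.comp (Primrec.pair (primrec_code_toFinset.comp Primrec.fst) Primrec.snd)
  refine ⟨codePair, Subtype.val, ⟨⟨fun y _ => y.2, Subtype.val_injective.injOn,
    fun n hn => ⟨⟨n, hn⟩, trivial, rfl⟩⟩, ?_⟩, primrecPred_isPoint.computablePred, ?_, ?_, ?_⟩
  · intro a α y b _ _ _ hb
    have hb' : codeOf a = code b := by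
      rw [codeOf]
      congr 1
      rw [← Finset.coe_inj, hb, Finset.coe_map]
      rfl
    have hb'' : ∀ i ∈ b, IsPoint i := by
      intro i hi
      rw [← Finset.mem_coe, hb] at hi
      obtain ⟨z, -, rfl⟩ := hi
      exact z.2
    rw [mem_codePair_j, ← hb']
    rw [and_iff_right (⟨hb'', α.2⟩ : (∀ i ∈ b, IsPoint i) ∧ IsPoint α.1)]
    exact (Part.mem_some_iff (a := web.i (a, α))).trans Subtype.ext_iff
  · refine (Computable.ofOption (Primrec.ite hdom (Primrec.option_some.comp hmap)
      (Primrec.const none)).to_comp).of_eq fun p => Part.ext fun y => ?_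
    rw [Part.mem_ofOption, mem_codePair_j]
    simp only [List.mem_toFinset, Option.mem_def]
    split_ifs with h
    · rw [and_iff_right h, Option.some.injEq, eq_comm]
    · simp [h]
  · refine hdom.computablePred.of_eq fun p => ?_
    rw [Part.dom_iff_mem]
    simp [mem_codePair_j]
  · have : PrimrecPred fun n => IsPoint n ∧ ¬ webInv n = none :=
      primrecPred_isPoint.and
        (PrimrecRel.comp Primrec.eq primrec_webInv (Primrec.const none)).not
    refine this.computablePred.of_eq fun n => ?_
    simp only [mem_codePair_j]
    constructor
    · rintro ⟨hn, h⟩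
      obtain ⟨p, hp⟩ := Option.ne_none_iff_exists'.1 h
      obtain ⟨h1, h2, h3⟩ := webInv_spec hn hp
      exact ⟨((bits p.1).toFinset, p.2), ⟨by simpa using h1, h2⟩, by simp [h3]⟩
    · rintro ⟨p, ⟨h1, h2⟩, rfl⟩
      exact ⟨isPoint_webMap (fun i hi => h1 i (mem_bits_code.1 hi)) h2, by simp⟩

/-! ### Minimality of the theories -/

namespace TotalPair

universe u v

/-- Membership in the interpretation of a term depends only on a finite part of the web, and is
preserved by the maps that preserve the total map on this finite part. -/
theorem exists_finite_support {H : Type u} (V : TotalPair H) (M : Term) (ρ : ℕ → Set H) (y : H)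
    (hy : y ∈ V.interp M ρ) : ∃ F : Finset H, y ∈ F ∧
      ∀ {G : Type v} [DecidableEq G] (W : TotalPair G) (ψ : H → G),
        (∀ (a : Finset H) (α : H), a ⊆ F → α ∈ F → V.i (a, α) ∈ F →
          W.i (a.image ψ, ψ α) = ψ (V.i (a, α))) →
        ∀ σ : ℕ → Set G, (∀ x, ∀ h ∈ ρ x, h ∈ F → ψ h ∈ σ x) → ψ y ∈ W.interp M σ := by
  classical
  induction M generalizing ρ y with
  | var x => exact ⟨{y}, by simp, fun W ψ _ σ hσ => hσ x y hy (by simp)⟩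
  | app M N ihM ihN =>
    obtain ⟨a, ha, hM⟩ := hy
    obtain ⟨F, hF, hF'⟩ := ihM ρ _ hM
    choose! E hE hE' using fun (β : H) (hβ : β ∈ a) => ihN ρ β (ha hβ)
    have h1 : F ⊆ insert y (F ∪ a.biUnion E) :=
      Finset.subset_union_left.trans (Finset.subset_insert _ _)
    have h2 : ∀ β ∈ a, E β ⊆ insert y (F ∪ a.biUnion E) := fun β hβ =>
      ((Finset.subset_biUnion_of_mem E hβ).trans Finset.subset_union_right).trans
        (Finset.subset_insert _ _)
    -- The support joins those of `V.i (a, y)` in `M` and of each `β ∈ a` in `N`. As each support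
    -- contains its own point, `a`, `y` and `V.i (a, y)` all lie in it, so `ψ` preserves this
    -- instance of the total map.
    refine ⟨insert y (F ∪ a.biUnion E), Finset.mem_insert_self _ _, fun W ψ hψ σ hσ => ?_⟩
    refine ⟨a.image ψ, ?_, ?_⟩
    · intro z hz
      obtain ⟨β, hβ, rfl⟩ := Finset.mem_image.1 hz
      refine hE' β hβ W ψ (fun b α hb hα h => hψ b α (hb.trans (h2 β hβ)) (h2 β hβ hα)
        (h2 β hβ h)) σ fun x h hx hh => hσ x h hx (h2 β hβ hh)
    · rw [hψ a y (fun β hβ => h2 β hβ (hE β hβ)) (Finset.mem_insert_self _ _) (h1 hF)]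
      exact hF' W ψ (fun b α hb hα h => hψ b α (hb.trans h1) (h1 hα) (h1 h)) σ
        fun x h hx hh => hσ x h hx (h1 hh)
  | lam x M ih =>
    obtain ⟨a, α, hα, rfl⟩ := hy
    obtain ⟨F, hF, hF'⟩ := ih _ _ hα
    have h1 : F ⊆ insert (V.i (a, α)) (F ∪ a) :=
      Finset.subset_union_left.trans (Finset.subset_insert _ _)
    have h2 : a ⊆ insert (V.i (a, α)) (F ∪ a) :=
      Finset.subset_union_right.trans (Finset.subset_insert _ _)
    refine ⟨insert (V.i (a, α)) (F ∪ a), Finset.mem_insert_self _ _, fun W ψ hψ σ hσ => ?_⟩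
    refine ⟨a.image ψ, ψ α, ?_, (hψ a α h2 (h1 hF) (Finset.mem_insert_self _ _)).symm⟩
    -- The bound variable has value `a` on one side and the image of `a` on the other, so the
    -- environments still correspond.
    refine hF' W ψ (fun b β hb hβ h => hψ b β (hb.trans h1) (h1 hβ) (h1 h)) _ fun z h hz hh => ?_
    by_cases hzx : z = x
    · subst hzx
      rw [Function.update_self] at hz ⊢
      exact Finset.mem_coe.2 (Finset.mem_image_of_mem _ hz)
    · rw [Function.update_of_ne hzx] at hz ⊢
      exact hσ z h hz (h1 hh)

/-- A partial map `θ` such that `θ (i (a, α)) = i (θ a, θ α)`, where both sides are defined as soon as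
`θ α` is, maps the interpretation of a term into its interpretation. -/
theorem interp_of_partial_morphism {G : Type u} {H : Type v} (W : TotalPair G) (V : TotalPair H)
    (θ : G → Option H)
    (hθ : ∀ a, ∃ b : Finset H, (∀ z, z ∈ b ↔ ∃ y ∈ a, θ y = some z) ∧
      ∀ α, θ (W.i (a, α)) = (θ α).map fun β => V.i (b, β))
    (M : Term) (σ : ℕ → Set G) (ρ : ℕ → Set H)
    (hσ : ∀ x, ∀ y ∈ σ x, ∀ h, θ y = some h → h ∈ ρ x) (y : G) (h : H)
    (hy : y ∈ W.interp M σ) (hh : θ y = some h) : h ∈ V.interp M ρ := by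
  induction M generalizing σ ρ y h with
  | var x => exact hσ x y hy h hh
  | app M N ihM ihN =>
    obtain ⟨a, ha, hM⟩ := hy
    obtain ⟨b, hb, hi⟩ := hθ a
    -- `b` contains only the defined images of elements of `a`; elements on which `θ` is undefined
    -- impose no condition.
    refine ⟨b, fun z hz => ?_, ihM σ ρ hσ _ _ hM (by rw [hi, hh, Option.map_some])⟩
    obtain ⟨w, hw, hwz⟩ := (hb z).1 hz
    exact ihN σ ρ hσ w z (ha hw) hwz
  | lam x M ih =>
    obtain ⟨a, α, hα, rfl⟩ := hy
    obtain ⟨b, hb, hi⟩ := hθ a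
    rw [hi] at hh
    obtain ⟨β, hβ, rfl⟩ := Option.map_eq_some_iff.1 hh
    refine ⟨b, β, ih _ _ (fun z w hw h' hh' => ?_) α β hα hβ, rfl⟩
    by_cases hzx : z = x
    · subst hzx
      rw [Function.update_self] at hw ⊢
      exact (hb _).2 ⟨w, hw, hh'⟩
    · rw [Function.update_of_ne hzx] at hw ⊢
      exact hσ z w hw h' hh'

end TotalPair

/-! ### The partial map from the free completion back to a total pair -/

section Retraction

universe u

variable {H : Type u} (V : TotalPair H) (k : ℕ) (φ : ℕ → H)

open Classical in
/-- The partial map from the free completion to a total pair that extends a map `φ` defined on the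
`k`-th component, and is undefined on the elements of the other components. -/
noncomputable def retraction (n : ℕ) : Option H :=
  if _hn : n % 2 = 0 then if (parts n).1 = k then some (φ (parts n).2) else none
  else (retraction (parts n).2).map fun β =>
    V.i (((bits (parts n).1).attach.filterMap fun i => retraction i.1).toFinset, β)
termination_by n
decreasing_by
  · exact lt_of_mem_bits_parts i.2
  · exact parts_snd_lt _hn

theorem retraction_atomCode (l x : ℕ) :
    retraction V k φ (atomCode l x) = if l = k then some (φ x) else none := by
  rw [retraction, dif_pos (by simp), parts_atomCode]

theorem retraction_formalPair (c α : ℕ) : ∃ b : Finset H,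
    (∀ z, z ∈ b ↔ ∃ i ∈ bits c, retraction V k φ i = some z) ∧
      retraction V k φ (formalPair c α) = (retraction V k φ α).map fun β => V.i (b, β) := by
  classical
  rw [retraction, dif_neg (by simp), parts_formalPair]
  refine ⟨_, fun z => ?_, rfl⟩
  simp

/-- On formal pairs the equation is the recursive definition. On atoms of the component `k` it is
the hypothesis that `φ` respects the table. On atoms of any other component both sides are
undefined, since argument and value lie in the same component. -/
theorem retraction_web_i
    (hφ : ∀ c α y, ((c, α), y) ∈ (table k).2 → ∀ b : Finset H,
      (∀ z, z ∈ b ↔ ∃ i ∈ bits c, φ i = z) → φ y = V.i (b, φ α)) (a : Finset Web) :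
    ∃ b : Finset H, (∀ z, z ∈ b ↔ ∃ y ∈ a, retraction V k φ y.1 = some z) ∧
      ∀ α, retraction V k φ (web.i (a, α)).1 =
        (retraction V k φ α.1).map fun β => V.i (b, β) := by
  -- The second argument `0` is a dummy: only the set `b` is needed, and it depends on `a` alone.
  obtain ⟨b, hb, -⟩ := retraction_formalPair V k φ (codeOf a) 0
  refine ⟨b, fun z => ?_, fun α => ?_⟩
  · rw [hb]
    constructor
    · rintro ⟨i, hi, h⟩
      obtain ⟨y, hy, rfl⟩ := mem_bits_codeOf.1 hi
      exact ⟨y, hy, h⟩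
    · rintro ⟨y, hy, h⟩
      exact ⟨y.1, val_mem_bits_codeOf.2 hy, h⟩
  · rw [web_i_val]
    rcases h : atomMap (codeOf a, α.1) with _ | y
    · obtain ⟨b', hb', e⟩ := retraction_formalPair V k φ (codeOf a) α.1
      obtain rfl : b' = b := Finset.ext fun z => (hb' z).trans (hb z).symm
      rw [webMap_of_atomMap_eq_none h, e]
    · rw [webMap_of_atomMap h]
      obtain ⟨l, c, α', y', h0, h1, rfl⟩ := atomMap_spec h
      rw [Prod.mk.injEq] at h1
      rw [h1.2, retraction_atomCode, retraction_atomCode]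
      split_ifs with hl
      · subst hl
        rw [Option.map_some, hφ c α' y' h0 b fun z => ?_]
        rw [hb, h1.1]
        simp only [mem_bits_shiftCode, exists_exists_and_eq_and, retraction_atomCode, if_true,
          Option.some.injEq]
      · rfl

end Retraction

/-! ### Finite restrictions of a total pair, and minimality -/

section FiniteSubpair

universe u

variable {H : Type u} (V : TotalPair H)

open Classical in
/-- The copy on a finite set of natural numbers of the restriction of a total pair to the finite
set `F`. -/
noncomputable def restriction (F : Finset H) (hF : F.Nonempty) (idx : H → ℕ) (φ : ℕ → H)
    (hφ : ∀ h ∈ F, φ (idx h) = h) : PartialPair ℕ where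
  carrier := idx '' F
  nonempty := hF.to_set.image idx
  j := fun p => Part.assert ((p.1 : Set ℕ) ⊆ idx '' F ∧ p.2 ∈ idx '' F ∧
    V.i (p.1.image φ, φ p.2) ∈ F) fun _ => Part.some (idx (V.i (p.1.image φ, φ p.2)))
  mem_carrier := by
    intro a α y h
    obtain ⟨⟨h1, h2, h3⟩, h4⟩ := Part.mem_assert_iff.1 h
    rw [Part.mem_some_iff] at h4
    exact ⟨h1, h2, h4 ▸ ⟨_, h3, rfl⟩⟩
  inj := by
    -- `φ` inverts `idx` on `F`, so a set of indices can be recovered from its image under `φ`; this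
    -- reduces injectivity to that of `V.i`.
    have key : ∀ a : Finset ℕ, (a : Set ℕ) ⊆ idx '' F → (a.image φ).image idx = a := by
      intro a ha
      rw [Finset.image_image]
      refine (Finset.image_congr fun n hn => ?_).trans Finset.image_id
      obtain ⟨h, hh, rfl⟩ := ha hn
      exact congrArg idx (hφ h hh)
    rintro ⟨a, α⟩ ⟨b, β⟩ y h h'
    obtain ⟨⟨h1, ⟨x, hx, rfl⟩, h3⟩, h4⟩ := Part.mem_assert_iff.1 h
    obtain ⟨⟨h1', ⟨x', hx', rfl⟩, h3'⟩, h4'⟩ := Part.mem_assert_iff.1 h'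
    rw [Part.mem_some_iff] at h4 h4'
    have e := V.inj ((hφ _ h3).symm.trans ((congrArg φ (h4.symm.trans h4')).trans (hφ _ h3')))
    rw [Prod.mk.injEq, hφ x hx, hφ x' hx'] at e
    rw [← key a h1, ← key b h1', e.1, e.2]

/-- The order theory of the free completion of the disjoint union of all the finite partial pairs
is contained in the order theory of every graph model. -/
theorem orderTheory_web_subset : web.orderTheory ⊆ V.orderTheory := by
  classical
  rintro ⟨M, N⟩ hMN ρ y hy
  obtain ⟨F, hyF, hF⟩ := V.exists_finite_support M ρ y hy
  obtain ⟨idx, hidx⟩ := Set.countable_iff_exists_injOn.1 F.countable_toSet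
  have : Nonempty H := ⟨y⟩
  set φ := Function.invFunOn idx (F : Set H)
  have hφ : ∀ h ∈ F, φ (idx h) = h := fun h hh =>
    hidx.leftInvOn_invFunOn hh
  obtain ⟨k, hk⟩ := isEffectiveNumeration_finitePair.surjective (restriction V F ⟨y, hyF⟩ idx φ hφ)
    (F.finite_toSet.image idx)
  have hmem : ∀ h ∈ F, (atom (k, idx h)).1 = atomCode k (idx h) := by
    intro h hh
    refine atom_val (show idx h ∈ (finitePair k).carrier from ?_)
    rw [hk]
    exact ⟨h, hh, rfl⟩
  have hθ := retraction_web_i V k φ (by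
    intro c α z hz b hb
    have : z ∈ (finitePair k).j ((bits c).toFinset, α) := by
      rw [mem_finitePair_j, code_toFinset_bits]
      exact hz
    rw [hk] at this
    obtain ⟨⟨h1, h2, h3⟩, h4⟩ := Part.mem_assert_iff.1 this
    rw [Part.mem_some_iff] at h4
    rw [h4, hφ _ h3]
    congr 2
    ext z
    rw [hb]
    simp)
  have hret : ∀ h ∈ F, retraction V k φ (atom (k, idx h)).1 = some h := by
    intro h hh
    rw [hmem h hh, retraction_atomCode, if_pos rfl, hφ h hh]
  -- The copying of `F` into the component `k` preserves the total map on `F`, so it transports the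
  -- membership of `y` to the free completion.
  have hM := hF web (fun h => atom (k, idx h)) (by
    intro a α ha hα h
    refine Subtype.ext ?_
    rw [web_i_val, hmem α hα, hmem _ h]
    refine webMap_of_atomMap ?_
    have hc : codeOf (a.image fun h => atom (k, idx h)) = shiftCode k (code (a.image idx)) := by
      refine bits_ext fun i => ?_
      rw [mem_bits_codeOf, mem_bits_shiftCode]
      simp only [Finset.mem_image, mem_bits_code, exists_exists_and_eq_and]
      exact exists_congr fun h => and_congr_right fun hh => by rw [hmem h (ha hh)]
    rw [hc]
    refine atomMap_of_mem_table ?_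
    have hj : idx (V.i (a, α)) ∈ (finitePair k).j (a.image idx, idx α) := by
      have e : V.i ((a.image idx).image φ, φ (idx α)) = V.i (a, α) := by
        rw [Finset.image_image, hφ α hα]
        congr 2
        exact (Finset.image_congr fun n hn => hφ n (ha hn)).trans Finset.image_id
      rw [hk]
      refine Part.mem_assert_iff.2 ⟨⟨?_, ⟨α, hα, rfl⟩, ?_⟩, ?_⟩
      · rw [Finset.coe_image]
        exact Set.image_mono ha
      · rwa [e]
      · rw [Part.mem_some_iff, e]
    exact mem_finitePair_j.1 hj)
    -- Only the copies of `ρ x ∩ F` are put in the environment, so that the retraction sends it back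
    -- into `ρ`.
    (fun x => {g | ∃ h ∈ ρ x, h ∈ F ∧ g = atom (k, idx h)}) fun x h hx hh => ⟨h, hx, hh, rfl⟩
  refine TotalPair.interp_of_partial_morphism web V (fun g => retraction V k φ g.1) hθ N _ ρ ?_ _ y
    (hMN _ hM) (hret y hyF)
  rintro x _ ⟨h, hx, hh, rfl⟩ h' e
  rw [hret h hh, Option.some.injEq] at e
  exact e ▸ hx

theorem eqTheory_web_subset : web.eqTheory ⊆ V.eqTheory := by
  rintro ⟨M, N⟩ h ρ
  exact subset_antisymm (orderTheory_web_subset V (fun σ => (h σ).subset) ρ)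
    (orderTheory_web_subset V (a := (N, M)) (fun σ => (h σ).superset) ρ)

end FiniteSubpair

/-! ### The free completion is an effective graph model -/

section Domain

theorem _root_.ComputablePred.and {α : Type*} [Primcodable α] {p q : α → Prop}
    (hp : ComputablePred p) (hq : ComputablePred q) : ComputablePred fun a => p a ∧ q a := by
  classical
  exact Computable.computablePred ((Primrec.and.to_comp.comp hp.decide hq.decide).of_eq
    fun a => (Bool.decide_and _ _).symm)

open Classical in
/-- The codes of elements of the free completion among the elements of the set coded by `c`. -/
noncomputable def points (c : ℕ) : List ℕ := (bits c).filter IsPoint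

theorem mem_points {c i : ℕ} : i ∈ points c ↔ i ∈ bits c ∧ IsPoint i := by
  simp [points]

theorem primrec_points : Primrec points := by
  classical
  exact (Primrec.listFilter primrecPred_isPoint).comp primrec_bits

/-- The numeration of the finite subsets of the free completion. -/
def finiteSet (c : ℕ) : Set Web := {y | y.1 ∈ bits c}

theorem finiteSet_codeOf (a : Finset Web) : finiteSet (codeOf a) = a := by
  ext y
  exact val_mem_bits_codeOf

theorem finite_finiteSet (c : ℕ) : (finiteSet c).Finite :=
  Set.Finite.preimage Subtype.val_injective.injOn (bits c).finite_toSet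

theorem exists_finiteSet_eq {X : Set Web} (hX : X.Finite) : ∃ c, finiteSet c = X :=
  ⟨codeOf hX.toFinset, by rw [finiteSet_codeOf, hX.coe_toFinset]⟩

theorem finiteSet_subset_iff {c : ℕ} {X : Set Web} :
    finiteSet c ⊆ X ↔ ∀ y : Web, y.1 ∈ points c → y ∈ X := by
  simp only [mem_points]
  exact ⟨fun h y hy => h hy.1, fun h y hy => h y ⟨hy, y.2⟩⟩

theorem finiteSet_subset_finiteSet {c c' : ℕ} :
    finiteSet c ⊆ finiteSet c' ↔ ∀ i ∈ points c, i ∈ bits c' := by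
  rw [finiteSet_subset_iff]
  exact ⟨fun h i hi => h ⟨i, (mem_points.1 hi).2⟩ hi, fun h y hy => h y.1 hy⟩

/-- Turns membership into inclusion of a compact element, the form in which decidability of values
of functions is given. -/
theorem finiteSet_singleton_subset {y : Web} {X : Set Web} :
    finiteSet (code [y.1].toFinset) ⊆ X ↔ y ∈ X := by
  rw [finiteSet_subset_iff]
  simp only [mem_points, mem_bits_code, List.mem_toFinset, List.mem_singleton]
  exact ⟨fun h => h y ⟨rfl, y.2⟩, fun h z hz => Subtype.ext hz.1 ▸ h⟩

theorem primrecPred_finiteSet_subset {α : Type*} [Primcodable α] {f g : α → ℕ} (hf : Primrec f)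
    (hg : Primrec g) : PrimrecPred fun a => finiteSet (f a) ⊆ finiteSet (g a) := by
  refine (PrimrecPred.forall_mem_list_of (p := fun a i => i ∈ bits (g a)) (primrec_points.comp hf)
    (PrimrecPred.primrecRel (p := fun q : α × ℕ => q.2 ∈ bits (g q.1)) (PrimrecPred.mem_list
      (primrec_bits.comp (hg.comp Primrec.fst)) Primrec.snd))).of_eq fun a => ?_
  exact finiteSet_subset_finiteSet.symm

theorem isEffectiveDomain_finiteSet : IsEffectiveDomain finiteSet where
  range_eq := by
    ext X
    exact ⟨by rintro ⟨c, rfl⟩; exact finite_finiteSet c, fun h => exists_finiteSet_eq h⟩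
  -- Any two sets are bounded by the whole web, so the relation is constantly true.
  bounded := (PrimrecPred.of_eq (p := fun _ => 0 = 0) (PrimrecRel.comp Primrec.eq
    (Primrec.const 0) (Primrec.const 0)) fun p => iff_of_true rfl
      ⟨Set.univ, Set.subset_univ _, Set.subset_univ _⟩).computablePred
  join := by
    have h1 : Primrec fun p : ℕ × ℕ × ℕ => p.2.1 := Primrec.fst.comp Primrec.snd
    have h2 : Primrec fun p : ℕ × ℕ × ℕ => p.2.2 := Primrec.snd.comp Primrec.snd
    have h3 : PrimrecPred fun p : ℕ × ℕ × ℕ =>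
        ∀ i ∈ points p.1, i ∈ bits p.2.1 ∨ i ∈ bits p.2.2 := by
      refine PrimrecPred.forall_mem_list_of
        (p := fun (p : ℕ × ℕ × ℕ) (i : ℕ) => i ∈ bits p.2.1 ∨ i ∈ bits p.2.2)
        (primrec_points.comp Primrec.fst) ?_
      exact PrimrecPred.primrecRel (p := fun q : (ℕ × ℕ × ℕ) × ℕ =>
        q.2 ∈ bits q.1.2.1 ∨ q.2 ∈ bits q.1.2.2)
        ((PrimrecPred.mem_list (primrec_bits.comp (h1.comp Primrec.fst)) Primrec.snd).or
          (PrimrecPred.mem_list (primrec_bits.comp (h2.comp Primrec.fst)) Primrec.snd))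
    refine (h3.and ((primrecPred_finiteSet_subset h1 Primrec.fst).and
      (primrecPred_finiteSet_subset h2 Primrec.fst))).computablePred.of_eq fun p => ?_
    rw [subset_antisymm_iff, Set.union_subset_iff, finiteSet_subset_iff (c := p.1)]
    refine and_congr_left' ⟨fun h y hy => h y.1 hy, fun h i hi =>
      h ⟨i, (mem_points.1 hi).2⟩ hi⟩

end Domain

/-! ### Finite joins of step functions -/

section StepFunctions

theorem stepJoin_le_iff {ι κ : Type} {D D' : Type*} [Preorder D] [CompleteLattice D'] {d : ι → D}
    {d' : κ → D'} {L : List (ι × κ)} {x : D} {z : D'} :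
    stepJoin d d' L x ≤ z ↔ ∀ p ∈ L, d p.1 ≤ x → d' p.2 ≤ z := by
  simp only [stepJoin, iSup_le_iff]

theorem le_stepJoin {ι κ : Type} {D D' : Type*} [Preorder D] [CompleteLattice D'] {d : ι → D}
    {d' : κ → D'} {L : List (ι × κ)} {x : D} {p : ι × κ} (hp : p ∈ L) (hx : d p.1 ≤ x) :
    d' p.2 ≤ stepJoin d d' L x :=
  stepJoin_le_iff.1 le_rfl p hp hx

theorem mem_stepJoin {ι κ : Type} {D G : Type*} [Preorder D] {d : ι → D}
    {d' : κ → Set G} {L : List (ι × κ)} {x : D} {z : G} :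
    z ∈ stepJoin d d' L x ↔ ∃ p ∈ L, d p.1 ≤ x ∧ z ∈ d' p.2 := by
  simp [stepJoin, and_left_comm]

/-- Finite sets are compact: once `d p.1` is contained in a directed union it is contained in a
member, so every step triggered at the union is triggered before. -/
theorem scottContinuous_stepJoin {G : Type*} {κ : Type} {D' : Type*} [CompleteLattice D']
    {d : ℕ → Set G} (hd : ∀ n, (d n).Finite) (d' : κ → D') (L : List (ℕ × κ)) :
    ScottContinuous (stepJoin d d' L) := by
  intro S hS hdir X hX
  obtain rfl : sSup S = X := (isLUB_sSup S).unique hX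
  constructor
  · rintro _ ⟨Y, hY, rfl⟩
    exact stepJoin_le_iff.2 fun p hp h => le_stepJoin hp (h.trans (le_sSup hY))
  · intro z hz
    refine stepJoin_le_iff.2 fun p hp h => ?_
    obtain ⟨Y, hY, hY'⟩ := DirectedOn.exists_mem_subset_of_finite_of_subset_sUnion hS hdir
      (hd p.1) h
    exact (le_stepJoin hp hY').trans (hz ⟨Y, hY, rfl⟩)

end StepFunctions

namespace TotalPair

variable {G : Type*} (W : TotalPair G)

theorem ap_mono {X X' Y Y' : Set G} (hX : X ⊆ X') (hY : Y ⊆ Y') : W.ap X Y ⊆ W.ap X' Y' :=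
  fun _ ⟨a, ha, h⟩ => ⟨a, ha.trans hY, hX h⟩

theorem abs_mono {f g : Set G → Set G} (h : f ≤ g) : W.abs f ⊆ W.abs g :=
  fun _ ⟨a, α, hα, e⟩ => ⟨a, α, h _ hα, e⟩

/-- Each result comes from an element of `X`, and by injectivity of `i` an element of `X` gives at
most one result. -/
theorem finite_ap {X : Set G} (hX : X.Finite) (Y : Set G) : (W.ap X Y).Finite :=
  ((hX.preimage W.inj.injOn).image Prod.snd).subset fun α ⟨a, _, h⟩ => ⟨(a, α), h, rfl⟩

theorem finite_foldl_ap {X : Set G} (hX : X.Finite) (es : List (Set G)) :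
    (es.foldl W.ap X).Finite := by
  induction es generalizing X with
  | nil => exact hX
  | cons Y es ih => exact ih (W.finite_ap hX Y)

end TotalPair

/-- Inverting the total map on the finitely many points of `m` lists all candidates `(a, α)`, so the
existential over finite sets `a` becomes a bounded one. -/
theorem finiteSet_subset_ap_iff {k m n : ℕ} :
    finiteSet k ⊆ web.ap (finiteSet m) (finiteSet n) ↔
      ∀ i ∈ points k, ∃ q ∈ (points m).filterMap webInv, q.2 = i ∧ ∀ l ∈ bits q.1, l ∈ bits n := by
  rw [finiteSet_subset_iff]
  constructor
  · intro h i hi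
    obtain ⟨a, ha, h⟩ := h ⟨i, (mem_points.1 hi).2⟩ hi
    refine ⟨(codeOf a, i), List.mem_filterMap.2
      ⟨_, mem_points.2 ⟨h, Subtype.prop _⟩, webInv_web_i _ _⟩, rfl, fun l hl => ?_⟩
    obtain ⟨y, hy, rfl⟩ := mem_bits_codeOf.1 hl
    exact ha hy
  · intro h y hy
    obtain ⟨q, hq, hqy, h⟩ := h y.1 hy
    obtain ⟨i, hi, hiq⟩ := List.mem_filterMap.1 hq
    rw [mem_points] at hi
    obtain ⟨a, α, ha, hα, e⟩ := exists_web_i_eq (y := ⟨i, hi.2⟩) hiq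
    obtain rfl : α = y := Subtype.ext (hα.trans hqy)
    refine ⟨a, fun z hz => h _ (ha ▸ val_mem_bits_codeOf.2 hz), ?_⟩
    rw [e]
    exact hi.1

/-- By injectivity a point lies in the abstraction exactly when it has an inverse image `(a, α)` and
this pair satisfies `α ∈ f a`; not every atom has an inverse image. -/
theorem finiteSet_subset_abs_iff {n : ℕ} {f : Set Web → Set Web} :
    finiteSet n ⊆ web.abs f ↔ (∀ i ∈ points n, webInv i ≠ none) ∧
      ∀ q ∈ (points n).filterMap webInv, finiteSet (code [q.2].toFinset) ⊆ f (finiteSet q.1) := by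
  rw [finiteSet_subset_iff]
  constructor
  · intro h
    refine ⟨fun i hi => ?_, fun q hq => ?_⟩
    · obtain ⟨a, α, -, e⟩ := h ⟨i, (mem_points.1 hi).2⟩ hi
      rw [show i = (web.i (a, α)).1 from congrArg Subtype.val e, webInv_web_i]
      exact Option.some_ne_none _
    · obtain ⟨i, hi, hiq⟩ := List.mem_filterMap.1 hq
      obtain ⟨a, α, hα, e⟩ := h ⟨i, (mem_points.1 hi).2⟩ hi
      rw [show i = (web.i (a, α)).1 from congrArg Subtype.val e, webInv_web_i,
        Option.some.injEq] at hiq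
      subst hiq
      rwa [finiteSet_singleton_subset, finiteSet_codeOf]
  · rintro ⟨h1, h2⟩ y hy
    obtain ⟨q, hq⟩ := Option.ne_none_iff_exists'.1 (h1 y.1 hy)
    obtain ⟨a, α, ha, hα, e⟩ := exists_web_i_eq hq
    have := h2 q (List.mem_filterMap.2 ⟨_, hy, hq⟩)
    rw [← hα, finiteSet_singleton_subset, ← ha, finiteSet_codeOf] at this
    exact ⟨a, α, this, e.symm⟩

theorem primrec_filterMap_webInv : Primrec fun n => (points n).filterMap webInv :=
  Primrec.listFilterMap primrec_points (primrec_webInv.comp Primrec.snd)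

theorem primrecPred_finiteSet_subset_ap : PrimrecPred fun p : ℕ × ℕ × ℕ =>
    finiteSet p.1 ⊆ web.ap (finiteSet p.2.1) (finiteSet p.2.2) := by
  refine PrimrecPred.of_eq ?_ fun p => finiteSet_subset_ap_iff.symm
  refine PrimrecPred.forall_mem_list_of (p := fun (p : ℕ × ℕ × ℕ) (i : ℕ) =>
    ∃ q ∈ (points p.2.1).filterMap webInv, q.2 = i ∧ ∀ l ∈ bits q.1, l ∈ bits p.2.2)
    (primrec_points.comp Primrec.fst) ?_
  refine PrimrecPred.primrecRel (p := fun r : (ℕ × ℕ × ℕ) × ℕ =>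
    ∃ q ∈ (points r.1.2.1).filterMap webInv, q.2 = r.2 ∧ ∀ l ∈ bits q.1, l ∈ bits r.1.2.2) ?_
  refine PrimrecPred.exists_mem_list_of (p := fun (r : (ℕ × ℕ × ℕ) × ℕ) (q : ℕ × ℕ) =>
    q.2 = r.2 ∧ ∀ l ∈ bits q.1, l ∈ bits r.1.2.2)
    (primrec_filterMap_webInv.comp (Primrec.fst.comp (Primrec.snd.comp Primrec.fst))) ?_
  refine PrimrecPred.primrecRel (p := fun s : ((ℕ × ℕ × ℕ) × ℕ) × (ℕ × ℕ) =>
    s.2.2 = s.1.2 ∧ ∀ l ∈ bits s.2.1, l ∈ bits s.1.1.2.2) ?_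
  refine (PrimrecRel.comp Primrec.eq (Primrec.snd.comp Primrec.snd)
    (Primrec.snd.comp Primrec.fst)).and ?_
  refine PrimrecPred.forall_mem_list_of (p := fun (s : ((ℕ × ℕ × ℕ) × ℕ) × (ℕ × ℕ)) (l : ℕ) =>
    l ∈ bits s.1.1.2.2) (primrec_bits.comp (Primrec.fst.comp Primrec.snd)) ?_
  exact PrimrecPred.primrecRel (p := fun t : (((ℕ × ℕ × ℕ) × ℕ) × (ℕ × ℕ)) × ℕ =>
    t.2 ∈ bits t.1.1.1.2.2) (PrimrecPred.mem_list (primrec_bits.comp (Primrec.snd.comp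
      (Primrec.snd.comp (Primrec.fst.comp (Primrec.fst.comp Primrec.fst))))) Primrec.snd)

/-- The parameter in `α` serves two uses: lists of steps, for abstraction as an r.e. element, and
`Unit`, for the abstraction of one fixed function. -/
theorem computablePred_finiteSet_subset_abs {α : Type*} [Primcodable α]
    {F : α → Set Web → Set Web}
    (hF : ComputablePred fun p : α × ℕ × ℕ => finiteSet p.2.2 ⊆ F p.1 (finiteSet p.2.1)) :
    ComputablePred fun p : α × ℕ => finiteSet p.2 ⊆ web.abs (F p.1) := by
  refine ComputablePred.of_eq (ComputablePred.and ?_ ?_) fun p => finiteSet_subset_abs_iff.symm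
  · have h : PrimrecPred fun i => webInv i ≠ none :=
      (PrimrecRel.comp Primrec.eq primrec_webInv (Primrec.const none)).not
    exact (h.forall_mem_list.comp (primrec_points.comp Primrec.snd)).computablePred
  · refine ComputablePred.forall_mem_list_of (p := fun r : (α × ℕ) × (ℕ × ℕ) =>
      finiteSet (code [r.2.2].toFinset) ⊆ F r.1.1 (finiteSet r.2.1))
      (primrec_filterMap_webInv.comp Primrec.snd).to_comp ?_
    have h : Primrec fun r : (α × ℕ) × (ℕ × ℕ) => code [r.2.2].toFinset :=
      primrec_code_toFinset.comp (Primrec.list_cons.comp (Primrec.snd.comp Primrec.snd)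
        (Primrec.const []))
    exact hF.comp (f := fun r : (α × ℕ) × (ℕ × ℕ) => (r.1.1, r.2.1, code [r.2.2].toFinset))
      (Primrec.pair (Primrec.fst.comp Primrec.fst)
        (Primrec.pair (Primrec.fst.comp Primrec.snd) h)).to_comp

theorem primrecPred_finiteSet_subset_stepJoin :
    PrimrecPred fun p : List (ℕ × ℕ) × ℕ × ℕ =>
      finiteSet p.2.2 ⊆ stepJoin finiteSet finiteSet p.1 (finiteSet p.2.1) := by
  have : PrimrecPred fun p : List (ℕ × ℕ) × ℕ × ℕ =>
      ∀ i ∈ points p.2.2, ∃ q ∈ p.1, finiteSet q.1 ⊆ finiteSet p.2.1 ∧ i ∈ bits q.2 := by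
    refine PrimrecPred.forall_mem_list_of (p := fun (p : List (ℕ × ℕ) × ℕ × ℕ) (i : ℕ) =>
      ∃ q ∈ p.1, finiteSet q.1 ⊆ finiteSet p.2.1 ∧ i ∈ bits q.2)
      (primrec_points.comp (Primrec.snd.comp Primrec.snd)) ?_
    refine PrimrecPred.primrecRel (p := fun r : (List (ℕ × ℕ) × ℕ × ℕ) × ℕ =>
      ∃ q ∈ r.1.1, finiteSet q.1 ⊆ finiteSet r.1.2.1 ∧ r.2 ∈ bits q.2) ?_
    refine PrimrecPred.exists_mem_list_of (p := fun (r : (List (ℕ × ℕ) × ℕ × ℕ) × ℕ) (q : ℕ × ℕ) =>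
      finiteSet q.1 ⊆ finiteSet r.1.2.1 ∧ r.2 ∈ bits q.2) (Primrec.fst.comp Primrec.fst) ?_
    refine PrimrecPred.primrecRel (p := fun s : ((List (ℕ × ℕ) × ℕ × ℕ) × ℕ) × (ℕ × ℕ) =>
      finiteSet s.2.1 ⊆ finiteSet s.1.1.2.1 ∧ s.1.2 ∈ bits s.2.2) ?_
    exact (primrecPred_finiteSet_subset (Primrec.fst.comp Primrec.snd) (Primrec.fst.comp
      (Primrec.snd.comp (Primrec.fst.comp Primrec.fst)))).and (PrimrecPred.mem_list
        (primrec_bits.comp (Primrec.snd.comp Primrec.snd)) (Primrec.snd.comp Primrec.fst))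
  refine this.of_eq fun p => ?_
  rw [finiteSet_subset_iff]
  simp only [mem_stepJoin]
  exact ⟨fun h y hy => h y.1 hy, fun h i hi => h ⟨i, (mem_points.1 hi).2⟩ hi⟩

/-- By monotonicity a join of steps lies below application or abstraction iff each step does at its
least triggering argument. For abstraction this argument is itself a finite join of steps, which is
Scott continuous and so an admissible test function. -/
theorem isWeaklyEffectiveModel_web : web.IsWeaklyEffectiveModel finiteSet where
  domain := isEffectiveDomain_finiteSet
  ap_re := by
    have h : PrimrecPred fun L : List (ℕ × List (ℕ × ℕ)) => ∀ p ∈ L, ∀ q ∈ p.2,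
        finiteSet q.2 ⊆ web.ap (finiteSet p.1) (finiteSet q.1) := by
      refine PrimrecPred.forall_mem_list (p := fun p : ℕ × List (ℕ × ℕ) => ∀ q ∈ p.2,
        finiteSet q.2 ⊆ web.ap (finiteSet p.1) (finiteSet q.1)) ?_
      refine PrimrecPred.forall_mem_list_of (p := fun (p : ℕ × List (ℕ × ℕ)) (q : ℕ × ℕ) =>
        finiteSet q.2 ⊆ web.ap (finiteSet p.1) (finiteSet q.1)) Primrec.snd ?_
      exact PrimrecPred.primrecRel (p := fun r : (ℕ × List (ℕ × ℕ)) × (ℕ × ℕ) =>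
        finiteSet r.2.2 ⊆ web.ap (finiteSet r.1.1) (finiteSet r.2.1))
        (primrecPred_finiteSet_subset_ap.comp (Primrec.pair (Primrec.snd.comp Primrec.snd)
          (Primrec.pair (Primrec.fst.comp Primrec.fst) (Primrec.fst.comp Primrec.snd))))
    refine h.computablePred.to_re.of_eq fun L => ⟨fun h X Y => ?_, fun h p hp q hq => ?_⟩
    · have : stepJoin finiteSet (stepJoin finiteSet finiteSet) L X ≤ web.ap X :=
        stepJoin_le_iff.2 fun p hp hX Y => stepJoin_le_iff.2 fun q hq hY =>
          (h p hp q hq).trans (web.ap_mono hX hY)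
      exact this Y
    · have : stepJoin finiteSet (stepJoin finiteSet finiteSet) L (finiteSet p.1) ≤
          web.ap (finiteSet p.1) := h (finiteSet p.1)
      exact stepJoin_le_iff.1 (stepJoin_le_iff.1 this p hp le_rfl _) q hq le_rfl
  abs_re := by
    have h : ComputablePred fun L : List (List (ℕ × ℕ) × ℕ) => ∀ p ∈ L,
        finiteSet p.2 ⊆ web.abs (stepJoin finiteSet finiteSet p.1) := by
      refine ComputablePred.forall_mem_list_of (f := fun L : List (List (ℕ × ℕ) × ℕ) => L)
        (p := fun r : List (List (ℕ × ℕ) × ℕ) × (List (ℕ × ℕ) × ℕ) =>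
          finiteSet r.2.2 ⊆ web.abs (stepJoin finiteSet finiteSet r.2.1)) Computable.id ?_
      exact (computablePred_finiteSet_subset_abs
        primrecPred_finiteSet_subset_stepJoin.computablePred).comp Computable.snd
    refine h.to_re.of_eq fun L => ⟨fun h f _ => ?_, fun h p hp => ?_⟩
    · exact stepJoin_le_iff.2 fun p hp hf => (h p hp).trans (web.abs_mono hf)
    · exact stepJoin_le_iff.1 (h _ (scottContinuous_stepJoin finite_finiteSet _ _)) p hp le_rfl

theorem isEffectiveModel_web : web.IsEffectiveModel := by
  refine ⟨finiteSet, isWeaklyEffectiveModel_web, fun n es _ => ?_, fun f _ hf => ?_⟩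
  -- The result of the applications is finite, and finite sets are decidable.
  · obtain ⟨c, hc⟩ := exists_finiteSet_eq (web.finite_foldl_ap (finite_finiteSet n) es)
    rw [← hc]
    exact (primrecPred_finiteSet_subset Primrec.id (Primrec.const c)).computablePred
  · have := computablePred_finiteSet_subset_abs (α := Unit) (F := fun _ => f)
      (hf.comp (f := fun p : Unit × ℕ × ℕ => p.2) Computable.snd)
    exact this.comp (f := fun n : ℕ => ((), n)) ((Computable.const ()).pair Computable.id)

end GraphModel

theorem mainTheorem6 :
    ∃ (N : ℕ → GraphModel.PartialPair ℕ) (G : Type) (W : GraphModel.TotalPair G) (e : ℕ × ℕ → G),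
      GraphModel.PartialPair.IsEffectiveNumeration N ∧
      W.IsFreeCompletion (GraphModel.PartialPair.disjointUnion N) e ∧
      W.toPartialPair.IsEffective ∧
      W.IsEffectiveModel ∧
      (∀ (H : Type*) (V : GraphModel.TotalPair H), W.orderTheory ⊆ V.orderTheory) ∧
      (∀ (H : Type*) (V : GraphModel.TotalPair H), W.eqTheory ⊆ V.eqTheory) :=
  ⟨GraphModel.finitePair, GraphModel.Web, GraphModel.web, GraphModel.atom,
    GraphModel.isEffectiveNumeration_finitePair, GraphModel.isFreeCompletion_web,
    GraphModel.isEffective_web, GraphModel.isEffectiveModel_web,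
    fun _ V => GraphModel.orderTheory_web_subset V, fun _ V => GraphModel.eqTheory_web_subset V⟩
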